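/- Let $X_1,X_2,\dots$ be independent identically distributed random variables with $\mathbf E X_1=0$, $\mathbf E X_1^2>0$, $\mathbf P(X_1\in\{-1,0,1,2,\dots\})=1$, whose distribution is lattice with maximal span $1$ (that is, for no real $d>1$ and $c$ is $X_1\in c+d\mathbb Z$ almost surely). Put $S_0=0$, $S_n=X_1+\dots+X_n$ and $\tau_x=\inf\{n\ge1: x+S_n\le0\}$, and for $j\ge1$, $n\ge0$ let $$a_n^{(j)}=[s^n](1-s)^{j-3/2}=(-1)^n\binom{j-\frac32}{n}.$$ Assume that $\mathbf E|X_1|^{r+3}<\infty$ for some integer $r\ge0$. Then there exist real polynomials $V_1,\dots,V_{\lfloor r/2\rfloor+1}$, with $V_j$ of degree $2j-1$, such that $$\mathbf P(\tau_x>n)=\sum_{j=1}^{\lfloor r/2\rfloor+1}V_j(x)\,a_n^{(j)}+O\left(\frac{1+x^{r+2}}{n^{(r+2)/2}}\right),\qquad n\ge1,$$ uniformly in the integers $x\ge1$. Explicitly, $$V_j(x)=\frac{x\,\theta_{j-1}(-x)}{j-\frac12},\qquad 1\le j\le\lfloor r/2\rfloor+1,$$ where $\theta_0,\dots,\theta_{\lfloor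 r/2\rfloor}$ are real polynomials, $\theta_k$ of degree $2k$, which are the coefficients of the local expansion $$\mathbf P(S_n=y)=\sum_{k=0}^{\lfloor r/2\rfloor}\theta_k(y)\,a_{n-1}^{(k+1)}+O\left(\frac{(1+|y|)^{r+1}}{n^{(r+2)/2}}\right),\qquad n\ge1,$$ uniformly in $y\in\mathbb Z$. -/

import Mathlib

open MeasureTheory ProbabilityTheory

noncomputable section

namespace LeftContinuousWalk

/-- The coefficient `a_n^{(j)} = [s^n] (1 - s)^{j - 3/2} = (-1)^n * binom(j - 3/2, n)`. -/
def a (j n : ℕ) : ℝ := (-1) ^ n * Ring.choose ((j : ℝ) - 3 / 2) n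

variable {Ω : Type*}

/-- The walk `S_n`, with `S_0 = 0`. The increments are numbered from `0`, so `X 0` is the first
increment and `S_n = X 0 + ... + X (n - 1)`. -/
def walk (X : ℕ → Ω → ℝ) (n : ℕ) (ω : Ω) : ℝ := ∑ i ∈ Finset.range n, X i ω

/-- The first passage time `τ_x = inf {n ≥ 1 : x + S_n ≤ 0}`, equal to `⊤` (that is, `∞`) if the
set is empty. -/
def passageTime (X : ℕ → Ω → ℝ) (x : ℝ) (ω : Ω) : ℕ∞ :=
  ⨅ (n : ℕ) (_ : 1 ≤ n ∧ x + walk X n ω ≤ 0), (n : ℕ∞)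

/-- The distribution of `Y` is concentrated on some arithmetic progression `c + d ℤ`. -/
def IsLatticeWithSpan [MeasurableSpace Ω] (P : Measure Ω) (Y : Ω → ℝ) (d : ℝ) : Prop :=
  ∃ c : ℝ, ∀ᵐ ω ∂P, ∃ k : ℤ, Y ω = c + k * d

/-- The distribution of `Y` is lattice with maximal span `1`. -/
def HasMaximalSpanOne [MeasurableSpace Ω] (P : Measure Ω) (Y : Ω → ℝ) : Prop :=
  IsLatticeWithSpan P Y 1 ∧ ∀ d : ℝ, 1 < d → ¬ IsLatticeWithSpan P Y d

end LeftContinuousWalk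

end

/-!
# First passage times of left-continuous walks: expansion of the tail

Let `φ` be the characteristic function of an increment. By Fourier inversion `P (S_n = y)` is the
Fourier coefficient of `φ ^ n` at `y`, and the proof rests on the asymptotics of the integrals
`J_n(F) = ∫ φ ^ n F` over `[-π, π]`.

*Local expansion.* Put `w ^ 2 = 1 / φ - 1`. Formally, the change of variables `t ↦ w` turns `φ ^ n`
into `(1 + w ^ 2) ^ (-n)`, and `∫ w ^ (2 k) (1 + w ^ 2) ^ (-n) dw` over the real line is a constant
multiple of `a_{n-1}^{(k+1)}`, while odd powers of `w` integrate to zero. So the sequences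
`a_{n-1}^{(k+1)}` are the natural scale for `J_n`, and the powers of `w` are the natural basis. The
change of variables itself is never made. In its place, `exists_formal_solution` gives the Taylor
polynomial `H` of `w ^ (2 k + 1)`, up to a factor, as the formal solution of a differential
equation, and integration by parts turns that equation into the recurrence of `a_{n-1}^{(k+1)}`
for the integrals `J_n(H')`, up to a summable error (`IsGaussianLike.exists_even_element`). The
odd powers correspond to exact derivatives
(`IsGaussianLike.isBigO_integral_odd_element`). Downward induction on the order of vanishing at `0`
then expands `J_n(t ^ l)` for every `l ≤ r` (`IsGaussianLike.exists_hasExpansion`), starting at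
`k = l / 2` or later, and the coefficient at `k = l / 2`, for even `l`, is nonzero by comparison
with a Gaussian integral. Replacing `exp (-i t y)` by its Taylor polynomial of degree `r` gives
polynomials `θ_k` of degree `2 k` in `y` and an error uniform in `y`
(`IsGaussianLike.exists_local_expansion`).

*First passage.* Kemperman's formula `P (τ_x = m) = (x / m) P (S_m = -x)` follows by induction on
the first step (`IsIID.measureReal_survives_eq`), and `τ_x` is almost surely finite
(`IsIID.tendsto_measureReal_survives`). So `P (τ_x > n)` is the sum of `(x / m) P (S_m = -x)` over
`m > n`. Since `a_{m-1}^{(k+1)} / m` is a multiple of `a_{m-1}^{(k+1)} - a_m^{(k+1)}`, the sum of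
the local expansion telescopes, and the polynomials `V_j` come out in the stated form
(`IsIID.survives_expansion`).
-/

open Filter Topology Polynomial Asymptotics
open scoped Real


namespace LeftContinuousWalk

/-! ### The coefficients of `(1 - s) ^ (j - 3 / 2)` -/

lemma a_zero (j : ℕ) : a j 0 = 1 := by simp [a]

lemma a_succ (j n : ℕ) : a j (n + 1) = a j n * ((n - j + 3 / 2) / (n + 1)) := by
  have h := Ring.choose_smul_choose ((j : ℝ) - 3 / 2) (Nat.le_succ n)
  simp only [Nat.succ_eq_add_one, Nat.choose_succ_self_right, nsmul_eq_mul,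
    Nat.add_sub_cancel_left, Ring.choose_one_right, Nat.cast_add, Nat.cast_one] at h
  have hn : (n : ℝ) + 1 ≠ 0 := by positivity
  have h' : Ring.choose ((j : ℝ) - 3 / 2) (n + 1) =
      Ring.choose ((j : ℝ) - 3 / 2) n * (((j : ℝ) - 3 / 2 - n) / (n + 1)) := by
    rw [← mul_div_assoc, eq_div_iff hn, ← h]
    ring
  rw [a, a, h', pow_succ]
  ring

lemma a_succ_recurrence (k n : ℕ) (hn : 1 ≤ n) :
    a (k + 1) n = (1 - ((k : ℝ) + 1 / 2) / n) * a (k + 1) (n - 1) := by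
  obtain ⟨m, rfl⟩ : ∃ m, n = m + 1 := ⟨n - 1, by omega⟩
  have hm : (m : ℝ) + 1 ≠ 0 := by positivity
  rw [a_succ, Nat.add_sub_cancel]
  push_cast
  field_simp
  ring

lemma nat_sub_half_ne_zero (k m : ℕ) : (m : ℝ) - ((k : ℝ) + 1 / 2) ≠ 0 := by
  intro h
  have h2 : ((2 * m : ℕ) : ℝ) = ((2 * k + 1 : ℕ) : ℝ) := by push_cast; linarith
  have h3 : 2 * m = 2 * k + 1 := by exact_mod_cast h2
  omega

lemma a_mul_factorial (k n : ℕ) :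
    a (k + 1) n * n.factorial * (-((k : ℝ) + 1 / 2)) =
      ∏ j ∈ Finset.range (n + 1), (-((k : ℝ) + 1 / 2) + j) := by
  induction n with
  | zero => simp [a_zero]
  | succ n ih =>
    rw [Finset.prod_range_succ, ← ih, a_succ, Nat.factorial_succ]
    have hm : (n : ℝ) + 1 ≠ 0 := by positivity
    push_cast
    field_simp
    ring

lemma a_succ_ne_zero (k n : ℕ) : a (k + 1) n ≠ 0 := by
  intro h
  have h1 := a_mul_factorial k n
  rw [h, zero_mul, zero_mul, eq_comm, Finset.prod_eq_zero_iff] at h1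
  obtain ⟨m, -, hm⟩ := h1
  exact nat_sub_half_ne_zero k m (by linarith)

/-- `a_n^{(k+1)} n^{k+1/2}` converges to a nonzero limit: up to a constant factor it is the
reciprocal of Euler's sequence for `Γ(-(k + 1/2))`. -/
lemma exists_tendsto_a (k : ℕ) :
    ∃ L : ℝ, L ≠ 0 ∧
      Tendsto (fun n : ℕ => a (k + 1) n * (n : ℝ) ^ ((k : ℝ) + 1 / 2)) atTop (𝓝 L) := by
  set κ : ℝ := (k : ℝ) + 1 / 2 with hκ
  have hκ0 : κ ≠ 0 := by positivity
  have hΓ : Real.Gamma (-κ) ≠ 0 := by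
    refine Real.Gamma_ne_zero fun m hm => nat_sub_half_ne_zero k m ?_
    rw [← hκ]; linarith
  refine ⟨(-κ * Real.Gamma (-κ))⁻¹, inv_ne_zero (mul_ne_zero (neg_ne_zero.2 hκ0) hΓ), ?_⟩
  have h := ((Real.GammaSeq_tendsto_Gamma (-κ)).const_mul (-κ)).inv₀
    (mul_ne_zero (neg_ne_zero.2 hκ0) hΓ)
  refine h.congr' ?_
  filter_upwards [eventually_ge_atTop 1] with n hn
  have hn0 : (0 : ℝ) < n := by exact_mod_cast hn
  have ha := a_succ_ne_zero k n
  have hf : (n.factorial : ℝ) ≠ 0 := by positivity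
  have hp : (n : ℝ) ^ κ ≠ 0 := (Real.rpow_pos_of_pos hn0 _).ne'
  rw [Real.GammaSeq, ← a_mul_factorial k n, Real.rpow_neg hn0.le, ← hκ]
  field_simp

lemma exists_bounds_a (k : ℕ) :
    ∃ c₁ c₂ : ℝ, 0 < c₁ ∧ 0 < c₂ ∧ ∀ n : ℕ, 1 ≤ n →
      c₁ * (n : ℝ) ^ (-((k : ℝ) + 1 / 2)) ≤ |a (k + 1) (n - 1)| ∧
      |a (k + 1) (n - 1)| ≤ c₂ * (n : ℝ) ^ (-((k : ℝ) + 1 / 2)) := by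
  set κ : ℝ := (k : ℝ) + 1 / 2 with hκ
  obtain ⟨L, hL, hlim⟩ := exists_tendsto_a k
  have hlim' : Tendsto (fun n : ℕ => |a (k + 1) (n - 1) * (n : ℝ) ^ κ|) atTop (𝓝 |L|) := by
    have h1 : Tendsto (fun n : ℕ => (1 - κ / (n : ℝ))⁻¹) atTop (𝓝 1) := by
      have := (tendsto_const_nhds (x := (1 : ℝ))).sub (tendsto_const_div_atTop_nhds_zero_nat κ)
      simpa using this.inv₀ (by simp)
    have h2 := (hlim.mul h1).abs
    rw [mul_one] at h2
    refine h2.congr' ?_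
    filter_upwards [eventually_ge_atTop 1] with n hn
    have hn0 : (n : ℝ) ≠ 0 := by positivity
    have hne : (1 - κ / (n : ℝ)) ≠ 0 := by
      intro h0
      refine nat_sub_half_ne_zero k n ?_
      field_simp at h0
      rw [← hκ]; linarith
    rw [a_succ_recurrence k n hn, ← hκ]
    congr 1
    rw [mul_comm, mul_assoc (1 - κ / (n : ℝ)), inv_mul_cancel_left₀ hne]
  have hinv := hlim'.inv₀ (abs_ne_zero.2 hL)
  obtain ⟨B, hB⟩ := hlim'.bddAbove_range
  obtain ⟨D, hD⟩ := hinv.bddAbove_range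
  refine ⟨(max D 1)⁻¹, max B 1, by positivity, by positivity, fun n hn => ?_⟩
  have hn0 : (0 : ℝ) < n := by exact_mod_cast hn
  have hp := Real.rpow_pos_of_pos hn0 κ
  have hB' := hB ⟨n, rfl⟩
  have hD' := hD ⟨n, rfl⟩
  simp only [abs_mul, abs_of_pos hp] at hB' hD'
  have ha : 0 < |a (k + 1) (n - 1)| := abs_pos.2 (a_succ_ne_zero _ _)
  rw [Real.rpow_neg hn0.le]
  constructor
  · rw [inv_mul_le_iff₀ (by positivity), inv_eq_one_div, div_le_iff₀ hp]
    have := (inv_le_iff_one_le_mul₀ (by positivity)).1 (hD'.trans (le_max_left D 1))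
    linarith
  · rw [← div_eq_mul_inv, le_div_iff₀ hp]
    exact hB'.trans (le_max_left _ _)

/-! ### Sums of powers and a perturbed first order recurrence -/

lemma rpow_neg_one_sub_le (β : ℝ) (hβ : 0 < β) (n : ℕ) (hn : 1 ≤ n) :
    ((n + 1 : ℕ) : ℝ) ^ (-1 - β) ≤ ((n : ℝ) ^ (-β) - ((n + 1 : ℕ) : ℝ) ^ (-β)) / β := by
  have hn0 : (0 : ℝ) < n := by exact_mod_cast hn
  have hn1 : (0 : ℝ) < ((n + 1 : ℕ) : ℝ) := by positivity
  set N : ℝ := ((n + 1 : ℕ) : ℝ) with hN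
  have hNn : N = n + 1 := by rw [hN]; push_cast; ring
  -- `(n / N) ^ (-β) ≥ 1 + β / N`
  have h1 : 1 + β / N ≤ ((n : ℝ) / N) ^ (-β) := by
    rw [Real.rpow_def_of_pos (by positivity)]
    have h2 : Real.log ((n : ℝ) / N) ≤ (n : ℝ) / N - 1 := Real.log_le_sub_one_of_pos (by positivity)
    have h3 : (n : ℝ) / N - 1 = - (1 / N) := by rw [hNn] at *; field_simp; ring
    have h4 : β / N ≤ Real.log ((n : ℝ) / N) * (-β) := by
      rw [h3] at h2
      have := mul_le_mul_of_nonneg_right h2 hβ.le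
      have h5 : β / N = 1 / N * β := by ring
      linarith
    linarith [Real.add_one_le_exp (Real.log ((n : ℝ) / N) * (-β))]
  have h6 : (n : ℝ) ^ (-β) = ((n : ℝ) / N) ^ (-β) * N ^ (-β) := by
    rw [← Real.mul_rpow (by positivity) hn1.le, div_mul_cancel₀ _ hn1.ne']
  have h7 : N ^ (-1 - β) = N ^ (-β) / N := by
    rw [show -1 - β = -β - 1 by ring, Real.rpow_sub_one hn1.ne']
  have hp := Real.rpow_pos_of_pos hn1 (-β)
  rw [le_div_iff₀ hβ, h6, h7]
  have := mul_le_mul_of_nonneg_right h1 hp.le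
  have h8 : N ^ (-β) / N * β = β / N * N ^ (-β) := by ring
  linarith

lemma rpow_succ_comparable (γ : ℝ) : ∃ K : ℝ, 0 < K ∧ ∀ n : ℕ, 1 ≤ n →
    (n : ℝ) ^ γ ≤ K * ((n + 1 : ℕ) : ℝ) ^ γ ∧ ((n + 1 : ℕ) : ℝ) ^ γ ≤ K * (n : ℝ) ^ γ := by
  refine ⟨2 ^ |γ|, by positivity, fun n hn => ?_⟩
  have hn0 : (0 : ℝ) < n := by exact_mod_cast hn
  have hn1 : (1 : ℝ) ≤ n := by exact_mod_cast hn
  have hN : (0 : ℝ) < ((n + 1 : ℕ) : ℝ) := by positivity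
  have key : ∀ u v : ℝ, 0 < u → 0 < v → u ≤ 2 * v → v ≤ 2 * u → u ^ γ ≤ 2 ^ |γ| * v ^ γ := by
    intro u v hu hv huv hvu
    rcases le_or_gt 0 γ with h | h
    · rw [abs_of_nonneg h, ← Real.mul_rpow (by norm_num) hv.le]
      exact Real.rpow_le_rpow hu.le huv h
    · rw [abs_of_neg h]
      have h1 : (2 * u) ^ γ ≤ v ^ γ := Real.rpow_le_rpow_of_nonpos hv hvu h.le
      rw [Real.mul_rpow (by norm_num) hu.le] at h1
      have h2 : (2 : ℝ) ^ (-γ) * (2 : ℝ) ^ γ = 1 := by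
        rw [← Real.rpow_add (by norm_num)]; simp
      calc u ^ γ = (2 : ℝ) ^ (-γ) * ((2 : ℝ) ^ γ * u ^ γ) := by rw [← mul_assoc, h2, one_mul]
        _ ≤ _ := by gcongr
  refine ⟨key _ _ hn0 hN ?_ ?_, key _ _ hN hn0 ?_ ?_⟩ <;> push_cast <;> linarith

lemma sum_rpow_le (β : ℝ) (hβ : 0 < β) (n N : ℕ) (hn : 1 ≤ n) (hN : n ≤ N) :
    ∑ m ∈ Finset.Ico n N, ((m + 1 : ℕ) : ℝ) ^ (-1 - β) ≤ (n : ℝ) ^ (-β) / β := by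
  have h : ∑ m ∈ Finset.Ico n N, ((m + 1 : ℕ) : ℝ) ^ (-1 - β) ≤
      ((n : ℝ) ^ (-β) - (N : ℝ) ^ (-β)) / β := by
    induction N, hN using Nat.le_induction with
    | base => simp
    | succ N hN ih =>
      rw [Finset.sum_Ico_succ_top hN]
      have := rpow_neg_one_sub_le β hβ N (hn.trans hN)
      calc _ ≤ _ := add_le_add ih this
        _ = _ := by ring
  refine h.trans ?_
  gcongr
  have : 0 ≤ (N : ℝ) ^ (-β) := by positivity
  linarith

lemma exists_limit_of_increments (D : ℕ → ℂ) (β C : ℝ) (hβ : 0 < β)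
    (hD : ∀ n : ℕ, 1 ≤ n → ‖D (n + 1) - D n‖ ≤ C * ((n + 1 : ℕ) : ℝ) ^ (-1 - β)) :
    ∃ R : ℂ, ∀ n : ℕ, 1 ≤ n → ‖D n - R‖ ≤ C / β * (n : ℝ) ^ (-β) := by
  have hC : 0 ≤ C := by
    have := (norm_nonneg _).trans (hD 1 le_rfl)
    exact nonneg_of_mul_nonneg_left this (by positivity)
  have hdist : ∀ n N : ℕ, 1 ≤ n → n ≤ N → ‖D N - D n‖ ≤ C / β * (n : ℝ) ^ (-β) := by
    intro n N hn hN
    have h1 : ‖D N - D n‖ ≤ ∑ m ∈ Finset.Ico n N, C * ((m + 1 : ℕ) : ℝ) ^ (-1 - β) := by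
      rw [← Finset.sum_Ico_sub D hN]
      exact norm_sum_le_of_le _ fun m hm => hD m (hn.trans (Finset.mem_Ico.1 hm).1)
    rw [← Finset.mul_sum] at h1
    calc _ ≤ _ := h1
      _ ≤ C * ((n : ℝ) ^ (-β) / β) := by gcongr; exact sum_rpow_le β hβ n N hn hN
      _ = _ := by ring
  have hlim : Tendsto (fun n : ℕ => C / β * (n : ℝ) ^ (-β)) atTop (𝓝 0) := by
    simpa using ((tendsto_rpow_neg_atTop hβ).comp tendsto_natCast_atTop_atTop).const_mul (C / β)
  have hcau : CauchySeq D := by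
    rw [Metric.cauchySeq_iff']
    intro ε hε
    obtain ⟨n, hn, h1⟩ := ((hlim.eventually (gt_mem_nhds hε)).and (eventually_ge_atTop 1)).exists
    exact ⟨n, fun N hN => by rw [dist_eq_norm]; exact (hdist n N h1 hN).trans_lt hn⟩
  obtain ⟨R, hR⟩ := cauchySeq_tendsto_of_complete hcau
  refine ⟨R, fun n hn => ?_⟩
  have h2 : Tendsto (fun N => ‖D n - D N‖) atTop (𝓝 ‖D n - R‖) := (hR.const_sub (D n)).norm
  refine le_of_tendsto h2 ?_
  filter_upwards [eventually_ge_atTop n] with N hN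
  rw [norm_sub_rev]
  exact hdist n N hn hN

/-- A solution of the recurrence satisfied by `n ↦ a_{n-1}^{(k+1)}`, perturbed by a summable
error, is a multiple of that sequence up to a smaller error. -/
lemma exists_multiple_of_recurrence (k : ℕ) (J : ℕ → ℂ) (γ C : ℝ) (hγ : (k : ℝ) + 1 / 2 < γ)
    (hJ : ∀ n : ℕ, 1 ≤ n →
      ‖J (n + 1) - (1 - (((k : ℝ) + 1 / 2 : ℝ) : ℂ) / n) * J n‖ ≤ C * (n : ℝ) ^ (-1 - γ)) :
    ∃ (R : ℂ) (C' : ℝ), ∀ n : ℕ, 1 ≤ n →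
      ‖J n - R * (a (k + 1) (n - 1) : ℝ)‖ ≤ C' * (n : ℝ) ^ (-γ) := by
  set κ : ℝ := (k : ℝ) + 1 / 2 with hκ
  obtain ⟨c₁, c₂, hc₁, hc₂, hb⟩ := exists_bounds_a k
  rw [← hκ] at hb
  obtain ⟨K, hK, hcmp⟩ := rpow_succ_comparable (-1 - γ)
  have hC : 0 ≤ C := by
    have := (norm_nonneg _).trans (hJ 1 le_rfl)
    exact nonneg_of_mul_nonneg_left this (by positivity)
  have hane : ∀ n : ℕ, ((a (k + 1) n : ℝ) : ℂ) ≠ 0 := fun n => by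
    exact_mod_cast a_succ_ne_zero k n
  obtain ⟨R, hR⟩ := exists_limit_of_increments (fun n => J n / (a (k + 1) (n - 1) : ℝ)) (γ - κ)
    (C * K / c₁) (by linarith) (by
      intro n hn
      have hn0 : (0 : ℝ) < n := by exact_mod_cast hn
      have hN : (0 : ℝ) < ((n + 1 : ℕ) : ℝ) := by positivity
      have hrec : ((a (k + 1) n : ℝ) : ℂ) =
          (1 - ((κ : ℝ) : ℂ) / n) * (a (k + 1) (n - 1) : ℝ) := by
        rw [a_succ_recurrence k n hn, ← hκ]; push_cast; rfl
      have heq : J (n + 1) / (a (k + 1) (n + 1 - 1) : ℝ) - J n / (a (k + 1) (n - 1) : ℝ) =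
          (J (n + 1) - (1 - ((κ : ℝ) : ℂ) / n) * J n) / (a (k + 1) n : ℝ) := by
        rw [Nat.add_sub_cancel, sub_div]
        congr 1
        rw [div_eq_div_iff (hane _) (hane _), hrec]
        ring
      rw [heq, norm_div, Complex.norm_real, Real.norm_eq_abs, div_le_iff₀ (abs_pos.2
        (a_succ_ne_zero k n))]
      have h1 := (hb (n + 1) (by omega)).1
      rw [Nat.add_sub_cancel] at h1
      have h2 : C * K / c₁ * ((n + 1 : ℕ) : ℝ) ^ (-1 - (γ - κ)) *
          (c₁ * ((n + 1 : ℕ) : ℝ) ^ (-κ)) = C * (K * ((n + 1 : ℕ) : ℝ) ^ (-1 - γ)) := by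
        rw [show -1 - γ = (-1 - (γ - κ)) + (-κ) by ring, Real.rpow_add hN]
        field_simp
      calc _ ≤ C * (n : ℝ) ^ (-1 - γ) := hJ n hn
        _ ≤ C * (K * ((n + 1 : ℕ) : ℝ) ^ (-1 - γ)) := by gcongr; exact (hcmp n hn).1
        _ = _ := h2.symm
        _ ≤ _ := by gcongr)
  refine ⟨R, C * K / c₁ / (γ - κ) * c₂, fun n hn => ?_⟩
  have hn0 : (0 : ℝ) < n := by exact_mod_cast hn
  have heq : J n - R * (a (k + 1) (n - 1) : ℝ) =
      (J n / (a (k + 1) (n - 1) : ℝ) - R) * (a (k + 1) (n - 1) : ℝ) := by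
    rw [sub_mul, div_mul_cancel₀ _ (hane _)]
  rw [heq, norm_mul, Complex.norm_real, Real.norm_eq_abs]
  have hγκ : 0 < γ - κ := by linarith
  calc _ ≤ (C * K / c₁ / (γ - κ) * (n : ℝ) ^ (-(γ - κ))) * (c₂ * (n : ℝ) ^ (-κ)) := by
        gcongr
        · exact hR n hn
        · exact (hb n hn).2
    _ = _ := by
        rw [show -γ = -(γ - κ) + (-κ) by ring, Real.rpow_add hn0]
        ring

/-! ### Gaussian moments over a period -/

/-- The filter of the interval `[-π, π]`: with it, `F =O[period] fun t => t ^ m` says that `F t` is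
at most a constant times `|t| ^ m` throughout this interval. -/
abbrev period : Filter ℝ := 𝓟 (Set.Icc (-π) π)

/-- The filter of the positive integers: with it, `=O[posNat]` is a bound valid for all
`n ≥ 1`. -/
abbrev posNat : Filter ℕ := 𝓟 (Set.Ici 1)

lemma integral_gaussian_moment_le (c : ℝ) (hc : 0 < c) (m : ℕ) :
    ∃ C : ℝ, 0 ≤ C ∧ ∀ n : ℕ, 1 ≤ n →
      ∫ t in (-π)..π, Real.exp (-(c * n) * t ^ 2) * |t| ^ m ≤
        C * (n : ℝ) ^ (-(((m : ℝ) + 1) / 2)) := by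
  refine ⟨2 * (c ^ (-(((m : ℝ) + 1) / 2)) * (1 / 2) * Real.Gamma (((m : ℝ) + 1) / 2)), ?_, ?_⟩
  · have : 0 ≤ Real.Gamma (((m : ℝ) + 1) / 2) := (Real.Gamma_pos_of_pos (by positivity)).le
    positivity
  intro n hn
  have hn0 : (0 : ℝ) < n := by exact_mod_cast hn
  have hb : 0 < c * n := by positivity
  set f : ℝ → ℝ := fun t => Real.exp (-(c * n) * t ^ 2) * t ^ m with hf
  have hfabs : ∀ t : ℝ, Real.exp (-(c * n) * t ^ 2) * |t| ^ m = f |t| := fun t => by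
    simp [hf, sq_abs]
  have hint : Integrable fun t : ℝ => Real.exp (-(c * n) * t ^ 2) * |t| ^ m := by
    have h := (integrable_rpow_mul_exp_neg_mul_sq hb (s := (m : ℝ))
      (by linarith [Nat.cast_nonneg (α := ℝ) m])).norm
    refine h.congr (ae_of_all _ fun t => ?_)
    simp [Real.rpow_natCast, mul_comm]
  have h1 : ∫ t in (-π)..π, Real.exp (-(c * n) * t ^ 2) * |t| ^ m ≤
      ∫ t : ℝ, Real.exp (-(c * n) * t ^ 2) * |t| ^ m := by
    rw [intervalIntegral.integral_of_le (by linarith [Real.pi_pos])]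
    exact setIntegral_le_integral hint (ae_of_all _ fun t => by positivity)
  have h2 : ∫ t : ℝ, Real.exp (-(c * n) * t ^ 2) * |t| ^ m =
      2 * ∫ t in Set.Ioi 0, f t := by
    simp_rw [hfabs]; exact integral_comp_abs
  have h3 : ∫ t in Set.Ioi 0, f t =
      (c * n) ^ (-(((m : ℝ) + 1) / 2)) * (1 / 2) * Real.Gamma (((m : ℝ) + 1) / 2) := by
    rw [← neg_div, ← integral_rpow_mul_exp_neg_mul_rpow (p := 2) (q := m) (by norm_num)
      (by linarith [Nat.cast_nonneg (α := ℝ) m]) hb]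
    refine setIntegral_congr_fun measurableSet_Ioi fun t _ => ?_
    simp [hf, Real.rpow_natCast, mul_comm]
  rw [h2, h3, Real.mul_rpow hc.le hn0.le] at h1
  calc _ ≤ _ := h1
    _ = _ := by ring

lemma isBigO_integral_of_le_gaussian (c : ℝ) (hc : 0 < c) (m : ℕ) (K : ℝ) (G : ℕ → ℝ → ℂ)
    (hG : ∀ n : ℕ, 1 ≤ n → ∀ t ∈ Set.Icc (-π) π,
      ‖G n t‖ ≤ K * (Real.exp (-(c * n) * t ^ 2) * |t| ^ m)) :
    (fun n => ∫ t in (-π)..π, G n t) =O[posNat]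
      fun n : ℕ => (n : ℝ) ^ (-(((m : ℝ) + 1) / 2)) := by
  obtain ⟨C, hC, hCb⟩ := integral_gaussian_moment_le c hc m
  have hK : 0 ≤ K := by
    have h := (norm_nonneg _).trans (hG 1 le_rfl 1
      ⟨by linarith [Real.pi_gt_three], by linarith [Real.pi_gt_three]⟩)
    exact nonneg_of_mul_nonneg_left h (by positivity)
  rw [isBigO_principal]
  refine ⟨K * C, fun n hn => ?_⟩
  have hn : 1 ≤ n := hn
  rw [Real.norm_of_nonneg (by positivity)]
  calc ‖∫ t in (-π)..π, G n t‖
      ≤ ∫ t in (-π)..π, K * (Real.exp (-(c * n) * t ^ 2) * |t| ^ m) := by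
        refine intervalIntegral.norm_integral_le_of_norm_le (by linarith [Real.pi_pos])
          (ae_of_all _ fun t ht => hG n hn t (Set.Ioc_subset_Icc_self ht)) ?_
        exact Continuous.intervalIntegrable (by fun_prop) _ _
    _ ≤ K * (C * (n : ℝ) ^ (-(((m : ℝ) + 1) / 2))) := by
        rw [intervalIntegral.integral_const_mul]
        exact mul_le_mul_of_nonneg_left (hCb n hn) hK
    _ = _ := by ring

lemma isBigO_pow_of_norm_lt (z : ℂ) (b : ℝ) (hb : 0 < b) (hz : ‖z‖ ≤ Real.exp (-b)) (s : ℝ) :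
    (fun n : ℕ => z ^ n) =O[posNat] fun n : ℕ => (n : ℝ) ^ (-s) := by
  have h := (tendsto_rpow_mul_exp_neg_mul_atTop_nhds_zero s b hb).comp
    tendsto_natCast_atTop_atTop
  obtain ⟨B, hB⟩ := h.bddAbove_range
  rw [isBigO_principal]
  refine ⟨B, fun n hn => ?_⟩
  have hn : 1 ≤ n := hn
  have hn0 : (0 : ℝ) < n := by exact_mod_cast hn
  rw [Real.norm_of_nonneg (by positivity), norm_pow, Real.rpow_neg hn0.le,
    ← div_eq_mul_inv, le_div_iff₀ (by positivity)]
  have h1 : ‖z‖ ^ n ≤ Real.exp (-b * n) := by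
    calc _ ≤ Real.exp (-b) ^ n := pow_le_pow_left₀ (norm_nonneg _) hz n
      _ = _ := by rw [← Real.exp_nat_mul]; ring_nf
  have h2 : (n : ℝ) ^ s * Real.exp (-b * n) ≤ B := hB ⟨n, rfl⟩
  have h3 := mul_le_mul_of_nonneg_right h1 (Real.rpow_nonneg hn0.le s)
  linarith

lemma isBigO_rpow_of_le {s s' : ℝ} (h : s' ≤ s) :
    (fun n : ℕ => (n : ℝ) ^ (-s)) =O[posNat] fun n : ℕ => (n : ℝ) ^ (-s') := by
  rw [isBigO_principal]
  refine ⟨1, fun n hn => ?_⟩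
  have hn : 1 ≤ n := hn
  have hn1 : (1 : ℝ) ≤ n := by exact_mod_cast hn
  rw [Real.norm_of_nonneg (by positivity), Real.norm_of_nonneg (by positivity), one_mul]
  exact Real.rpow_le_rpow_of_exponent_le hn1 (by linarith)

/-! ### Orders of vanishing -/

lemma isBigO_pow_of_le {m m' : ℕ} (h : m' ≤ m) :
    (fun t : ℝ => t ^ m) =O[period] fun t => t ^ m' := by
  rw [isBigO_principal]
  refine ⟨π ^ (m - m'), fun t ht => ?_⟩
  rw [norm_pow, norm_pow, ← Nat.sub_add_cancel h, pow_add, Nat.add_sub_cancel]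
  gcongr
  exact abs_le.2 ht

lemma isBigO_one_of_continuous {F : ℝ → ℂ} (hF : Continuous F) :
    F =O[period] fun t : ℝ => t ^ 0 := by
  rw [isBigO_principal]
  obtain ⟨C, hC⟩ := isCompact_Icc.exists_bound_of_continuousOn (s := Set.Icc (-π) π)
    hF.continuousOn
  exact ⟨C, fun t ht => by simpa using hC t ht⟩

lemma isBigO_mul {F G : ℝ → ℂ} {m m' : ℕ} (hF : F =O[period] fun t => t ^ m)
    (hG : G =O[period] fun t => t ^ m') :
    (fun t => F t * G t) =O[period] fun t => t ^ (m + m') := by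
  simpa [pow_add] using hF.mul hG

lemma isBigO_mul_continuous {F G : ℝ → ℂ} {m : ℕ} (hF : F =O[period] fun t => t ^ m)
    (hG : Continuous G) : (fun t => F t * G t) =O[period] fun t => t ^ m :=
  isBigO_mul hF (isBigO_one_of_continuous hG)

lemma continuous_eval_ofReal (g : ℂ[X]) : Continuous fun t : ℝ => g.eval (t : ℂ) :=
  g.continuous.comp Complex.continuous_ofReal

lemma isBigO_eval_of_dvd {g : ℂ[X]} {m : ℕ} (h : X ^ m ∣ g) :
    (fun t : ℝ => g.eval (t : ℂ)) =O[period] fun t => t ^ m := by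
  obtain ⟨q, rfl⟩ := h
  have h1 : (fun t : ℝ => ((t : ℂ)) ^ m) =O[period] fun t => t ^ m :=
    isBigO_of_le _ fun t => by simp
  simpa using isBigO_mul_continuous h1 (continuous_eval_ofReal q)

/-! ### Formal solutions -/

/-- The polynomial `H = X^(2k+1) + ⋯` solves, to any prescribed order, the equation
`H' U + (k + 1/2) H T' = 0`, where `U = X^2 (v + ⋯)` and `T' = X (-2 v + ⋯)`. For
`U = (1 - T) T` the exact solution is a multiple of `((1 - T) / T) ^ (k + 1/2)`. -/
lemma exists_formal_solution (k : ℕ) (v : ℂ) (hv : v ≠ 0) (u w : ℂ[X]) (N : ℕ) :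
    ∃ G : ℂ[X], X ^ N ∣
      derivative (X ^ (2 * k + 1) + X ^ (2 * k + 2) * G) * (X ^ 2 * (C v + X * u)) +
        C ((k : ℂ) + 1 / 2) * (X ^ (2 * k + 1) + X ^ (2 * k + 2) * G) *
          (X * (-2 * C v + X * w)) := by
  suffices h : ∀ N : ℕ, ∃ G : ℂ[X], X ^ (2 * k + 3 + N) ∣
      derivative (X ^ (2 * k + 1) + X ^ (2 * k + 2) * G) * (X ^ 2 * (C v + X * u)) +
        C ((k : ℂ) + 1 / 2) * (X ^ (2 * k + 1) + X ^ (2 * k + 2) * G) *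
          (X * (-2 * C v + X * w)) by
    obtain ⟨G, hG⟩ := h N
    exact ⟨G, (pow_dvd_pow X (by omega)).trans hG⟩
  have hκ : C ((k : ℂ) + 1 / 2) * 2 = (((2 * k + 1 : ℕ) : ℂ[X])) := by
    rw [show (2 : ℂ[X]) = C 2 from rfl, ← C_mul,
      show ((k : ℂ) + 1 / 2) * 2 = ((2 * k + 1 : ℕ) : ℂ) by push_cast; ring]
    exact map_natCast C _
  intro N
  induction N with
  | zero =>
    refine ⟨0, (((2 * k + 1 : ℕ) : ℂ[X])) * u + C ((k : ℂ) + 1 / 2) * w, ?_⟩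
    rw [mul_zero, add_zero, derivative_X_pow, Nat.add_sub_cancel, add_zero]
    have hC : C (((2 * k + 1 : ℕ) : ℂ)) = (((2 * k + 1 : ℕ) : ℂ[X])) := map_natCast C _
    rw [hC]
    linear_combination (-(C v) * X ^ (2 * k + 2)) * hκ
  | succ N ih =>
    obtain ⟨G, q, hq⟩ := ih
    set b : ℂ := -(q.coeff 0) / ((N + 1) * v) with hb
    have hN : ((N : ℂ) + 1) ≠ 0 := by exact_mod_cast Nat.succ_ne_zero N
    -- the correction `b X^(2k+2+N)` cancels the lowest coefficient of the remainder
    obtain ⟨q₁, hq₁⟩ : ∃ q₁, q = C (q.coeff 0) + X * q₁ :=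
      ⟨q.divX, by rw [add_comm]; exact (X_mul_divX_add q).symm⟩
    have hb' : C b * (((N + 1 : ℕ) : ℂ[X])) * C v = - C (q.coeff 0) := by
      rw [show (((N + 1 : ℕ) : ℂ[X])) = C ((N : ℂ) + 1) by simp, ← C_mul, ← C_mul, ← C_neg]
      congr 1
      rw [hb]; field_simp
    refine ⟨G + C b * X ^ N, q₁ + C b * ((((2 * k + 2 + N : ℕ) : ℂ[X])) * u +
      C ((k : ℂ) + 1 / 2) * w), ?_⟩
    have hsplit : X ^ (2 * k + 1) + X ^ (2 * k + 2) * (G + C b * X ^ N) =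
        (X ^ (2 * k + 1) + X ^ (2 * k + 2) * G) + C b * X ^ (2 * k + 1 + N + 1) := by ring
    rw [hsplit, derivative_add, derivative_C_mul, derivative_X_pow, Nat.add_sub_cancel]
    have hC : C (((2 * k + 1 + N + 1 : ℕ) : ℂ)) = (((2 * k + 1 + N + 1 : ℕ) : ℂ[X])) :=
      map_natCast C _
    rw [hC]
    have e1 : (((2 * k + 1 + N + 1 : ℕ) : ℂ[X])) =
        (((2 * k + 1 : ℕ) : ℂ[X])) + (((N + 1 : ℕ) : ℂ[X])) := by push_cast; ring
    have e2 : (((2 * k + 2 + N : ℕ) : ℂ[X])) =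
        (((2 * k + 1 : ℕ) : ℂ[X])) + (((N + 1 : ℕ) : ℂ[X])) := by push_cast; ring
    rw [e1, e2]
    rw [hq₁] at hq
    linear_combination hq + X ^ (2 * k + 3 + N) * hb' -
      (C b * C v * X ^ (2 * k + 3 + N)) * hκ

/-! ### Asymptotics of `∫ φ ^ n F` -/

/-- What the expansion uses about the characteristic function `φ` of an increment on `[-π, π]`:
it is continuously differentiable, is dominated there by a Gaussian, and is approximated together
with its derivative by a polynomial `T = 1 - v t^2 + ⋯`, to orders `r + 3` and `r + 2`. -/
structure IsGaussianLike (r : ℕ) (φ φ' : ℝ → ℂ) (T : ℂ[X]) (v c : ℝ) : Prop where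
  hasDerivAt : ∀ t, HasDerivAt φ (φ' t) t
  continuous_deriv : Continuous φ'
  pos : 0 < c
  le : c ≤ v
  norm_le : ∀ t ∈ Set.Icc (-π) π, ‖φ t‖ ≤ Real.exp (-c * t ^ 2)
  poly : ∃ u : ℂ[X], T = 1 - X ^ 2 * (C (v : ℂ) + X * u)
  taylor : (fun t => φ t - T.eval (t : ℂ)) =O[period] fun t => t ^ (r + 3)
  taylor_deriv : (fun t => φ' t - T.derivative.eval (t : ℂ)) =O[period] fun t => t ^ (r + 2)

/-- The integral of `φ ^ n F` over a period. -/
noncomputable def J (φ : ℝ → ℂ) (n : ℕ) (F : ℝ → ℂ) : ℂ := ∫ t in (-π)..π, φ t ^ n * F t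

/-- `∫ φ ^ n F` is a combination, with coefficients `d k`, of the sequences `a_{n-1}^{(k+1)}` with
`k ≤ r / 2`, up to `O(n ^ (-(r + 2) / 2))`. -/
def HasExpansion (r : ℕ) (φ : ℝ → ℂ) (F : ℝ → ℂ) (d : ℕ → ℂ) : Prop :=
  (fun n => J φ n F - ∑ k ∈ Finset.range (r / 2 + 1), d k * (a (k + 1) (n - 1) : ℝ)) =O[posNat]
    fun n : ℕ => (n : ℝ) ^ (-(((r : ℝ) + 2) / 2))

section

variable {r : ℕ} {φ φ' : ℝ → ℂ} {T : ℂ[X]} {v c : ℝ}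

lemma J_add (hφ : Continuous φ) {F G : ℝ → ℂ} (hF : Continuous F) (hG : Continuous G) (n : ℕ) :
    J φ n (fun t => F t + G t) = J φ n F + J φ n G := by
  rw [J, J, J, ← intervalIntegral.integral_add]
  · simp_rw [mul_add]
  all_goals exact Continuous.intervalIntegrable (by fun_prop) _ _

lemma J_sub (hφ : Continuous φ) {F G : ℝ → ℂ} (hF : Continuous F) (hG : Continuous G) (n : ℕ) :
    J φ n (fun t => F t - G t) = J φ n F - J φ n G := by
  rw [J, J, J, ← intervalIntegral.integral_sub]
  · simp_rw [mul_sub]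
  all_goals exact Continuous.intervalIntegrable (by fun_prop) _ _

lemma J_const_mul (F : ℝ → ℂ) (b : ℂ) (n : ℕ) :
    J φ n (fun t => b * F t) = b * J φ n F := by
  rw [J, J, ← intervalIntegral.integral_const_mul]
  congr 1; ext t; ring

lemma HasExpansion.add (hφ : Continuous φ) {F G : ℝ → ℂ} (hF : Continuous F) (hG : Continuous G)
    {d e : ℕ → ℂ} (h : HasExpansion r φ F d) (h' : HasExpansion r φ G e) :
    HasExpansion r φ (fun t => F t + G t) (fun k => d k + e k) := by
  unfold HasExpansion at *
  refine (IsBigO.add h h').congr_left fun n => ?_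
  rw [J_add hφ hF hG]
  simp_rw [add_mul, Finset.sum_add_distrib]
  ring

lemma HasExpansion.const_mul {F : ℝ → ℂ} {d : ℕ → ℂ} (h : HasExpansion r φ F d) (b : ℂ) :
    HasExpansion r φ (fun t => b * F t) (fun k => b * d k) := by
  unfold HasExpansion at *
  refine (h.const_mul_left b).congr_left fun n => ?_
  rw [J_const_mul, mul_sub, Finset.mul_sum]
  simp_rw [mul_assoc]

lemma derivative_eq_of_eq_one_sub {u : ℂ[X]} (hu : T = 1 - X ^ 2 * (C (v : ℂ) + X * u)) :
    derivative T = X * (-2 * C (v : ℂ) + X * (-3 * u - X * derivative u)) := by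
  rw [hu]
  simp only [derivative_sub, derivative_one, derivative_mul, derivative_X_pow, derivative_add,
    derivative_C, derivative_X, Nat.cast_ofNat]
  simp only [map_ofNat]
  ring

namespace IsGaussianLike

variable (h : IsGaussianLike r φ φ' T v c)

include h

lemma continuous : Continuous φ :=
  continuous_iff_continuousAt.2 fun t => (h.hasDerivAt t).continuousAt

lemma norm_pow_pred_le {n : ℕ} (hn : 1 ≤ n) {t : ℝ} (ht : t ∈ Set.Icc (-π) π) :
    Real.exp (-c * t ^ 2) ^ (n - 1) ≤ Real.exp (c * π ^ 2) * Real.exp (-(c * n) * t ^ 2) := by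
  rw [← Real.exp_nat_mul, ← Real.exp_add, Nat.cast_sub hn]
  refine Real.exp_le_exp.2 ?_
  have h1 : t ^ 2 ≤ π ^ 2 := sq_le_sq' ht.1 ht.2
  have h2 := mul_le_mul_of_nonneg_left h1 h.pos.le
  push_cast
  nlinarith

lemma isBigO_integral_pred {F : ℝ → ℂ} {m : ℕ} (hF : F =O[period] fun t => t ^ m) :
    (fun n => J φ (n - 1) F) =O[posNat] fun n : ℕ => (n : ℝ) ^ (-(((m : ℝ) + 1) / 2)) := by
  obtain ⟨K, hK⟩ := isBigO_principal.1 hF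
  refine isBigO_integral_of_le_gaussian c h.pos m (Real.exp (c * π ^ 2) * K) _ ?_
  intro n hn t ht
  rw [norm_mul, norm_pow]
  have h1 := (pow_le_pow_left₀ (norm_nonneg _) (h.norm_le t ht) (n - 1)).trans
    (h.norm_pow_pred_le hn ht)
  have h2 := hK t ht
  rw [norm_pow, Real.norm_eq_abs] at h2
  calc _ ≤ (Real.exp (c * π ^ 2) * Real.exp (-(c * n) * t ^ 2)) * (K * |t| ^ m) := by gcongr
    _ = _ := by ring

lemma isBigO_integral {F : ℝ → ℂ} {m : ℕ} (hF : F =O[period] fun t => t ^ m) :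
    (fun n => J φ n F) =O[posNat] fun n : ℕ => (n : ℝ) ^ (-(((m : ℝ) + 1) / 2)) := by
  refine (h.isBigO_integral_pred (isBigO_mul_continuous hF h.continuous)).congr' ?_
    EventuallyEq.rfl
  refine eventually_principal.2 fun n hn => ?_
  have hn : 1 ≤ n := hn
  simp only [J]
  congr 1; ext t
  rw [mul_comm (F t), ← mul_assoc, ← pow_succ, Nat.sub_add_cancel hn]

lemma isBigO_boundary (F : ℝ → ℂ) (s : ℝ) :
    (fun n => φ π ^ n * F π - φ (-π) ^ n * F (-π)) =O[posNat]
      fun n : ℕ => (n : ℝ) ^ (-s) := by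
  have hb : 0 < c * π ^ 2 := by have := h.pos; positivity
  have h1 : ‖φ π‖ ≤ Real.exp (-(c * π ^ 2)) := by
    rw [← neg_mul]
    exact h.norm_le π ⟨by linarith [Real.pi_pos], le_rfl⟩
  have h2 : ‖φ (-π)‖ ≤ Real.exp (-(c * π ^ 2)) := by
    rw [← neg_mul, ← neg_sq π]
    exact h.norm_le (-π) ⟨le_rfl, by linarith [Real.pi_pos]⟩
  have k1 := (isBigO_pow_of_norm_lt _ _ hb h1 s).const_mul_left (F π)
  have k2 := (isBigO_pow_of_norm_lt _ _ hb h2 s).const_mul_left (F (-π))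
  refine (k1.sub k2).congr_left fun n => ?_
  ring

lemma integral_by_parts (g : ℂ[X]) (n : ℕ) :
    J φ n (fun t => (derivative g).eval (t : ℂ)) +
        n * J φ (n - 1) (fun t => φ' t * g.eval (t : ℂ)) =
      φ π ^ n * g.eval ((π : ℝ) : ℂ) - φ (-π) ^ n * g.eval (((-π : ℝ)) : ℂ) := by
  have hφ := h.continuous
  have hφ' := h.continuous_deriv
  have hg := continuous_eval_ofReal g
  have hg' := continuous_eval_ofReal (derivative g)
  have hd : ∀ t ∈ Set.uIcc (-π) π, HasDerivAt (fun t : ℝ => φ t ^ n * g.eval (t : ℂ))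
      (φ t ^ n * (derivative g).eval (t : ℂ) +
        n * (φ t ^ (n - 1) * (φ' t * g.eval (t : ℂ)))) t := by
    intro t _
    have h1 := ((h.hasDerivAt t).pow n).mul ((g.hasDerivAt (t : ℂ)).comp_ofReal)
    refine h1.congr_deriv ?_
    simp only [Pi.pow_apply]
    ring
  rw [← intervalIntegral.integral_eq_sub_of_hasDerivAt hd
    (Continuous.intervalIntegrable (by fun_prop) _ _), intervalIntegral.integral_add,
    intervalIntegral.integral_const_mul, J, J]
  all_goals exact Continuous.intervalIntegrable (by fun_prop) _ _

lemma v_ne_zero : (v : ℂ) ≠ 0 := by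
  exact_mod_cast (h.pos.trans_le h.le).ne'

/-- For every `k` with `2 k ≤ r` there is a polynomial vanishing at `0` exactly to order `2 k` whose
integrals against `φ ^ n` are, up to a small error, a multiple of `a_{n-1}^{(k+1)}`: integration
by parts turns the formal differential equation into the recurrence of this sequence. -/
lemma exists_even_element {k : ℕ} (hk : 2 * k ≤ r) :
    ∃ (G : ℂ[X]) (R : ℂ),
      (fun n => J φ n (fun t => (derivative (X ^ (2 * k + 1) + X ^ (2 * k + 2) * G)).eval (t : ℂ))
        - R * (a (k + 1) (n - 1) : ℝ)) =O[posNat]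
        fun n : ℕ => (n : ℝ) ^ (-(((r : ℝ) + 2) / 2)) := by
  obtain ⟨u, hu⟩ := h.poly
  have hT' := derivative_eq_of_eq_one_sub hu
  have hU : (1 - T) * T = X ^ 2 * (C (v : ℂ) + X *
      (u - X * (C (v : ℂ) + X * u) ^ 2)) := by
    rw [hu]; ring
  obtain ⟨G, hG⟩ := exists_formal_solution k (v : ℂ) h.v_ne_zero
    (u - X * (C (v : ℂ) + X * u) ^ 2) (-3 * u - X * derivative u) (r + 3)
  rw [← hU, ← hT'] at hG
  set H : ℂ[X] := X ^ (2 * k + 1) + X ^ (2 * k + 2) * G with hH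
  set κ : ℝ := (k : ℝ) + 1 / 2 with hκ
  have hκc : ((k : ℂ) + 1 / 2) = (κ : ℂ) := by rw [hκ]; push_cast; rfl
  rw [hκc] at hG
  have hφ := h.continuous
  have hφ' := h.continuous_deriv
  have hHc := continuous_eval_ofReal H
  have hHc' := continuous_eval_ofReal (derivative H)
  have hTc := continuous_eval_ofReal T
  -- `E` is the defect of `H` in the differential equation with `φ` in place of `T`
  set E : ℝ → ℂ := fun t => (derivative H).eval (t : ℂ) * ((1 - φ t) * φ t) +
    κ * (φ' t * H.eval (t : ℂ)) with hE
  have hEO : E =O[period] fun t => t ^ (r + 3) := by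
    have e1 := isBigO_eval_of_dvd hG
    have e2 := isBigO_mul_continuous h.taylor
      (G := fun t => (derivative H).eval (t : ℂ) * (1 - φ t - T.eval (t : ℂ))) (by fun_prop)
    have e3 := isBigO_mul (isBigO_eval_of_dvd (g := C (κ : ℂ) * H) (m := 1)
      (Dvd.dvd.mul_left ⟨X ^ (2 * k) + X ^ (2 * k + 1) * G, by rw [hH]; ring⟩ _)) h.taylor_deriv
    rw [show 1 + (r + 2) = r + 3 by ring] at e3
    refine ((e1.add e2).add e3).congr_left fun t => ?_
    simp only [hE, eval_add, eval_mul, eval_sub, eval_one, eval_C]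
    ring
  set Jn : ℕ → ℂ := fun n => J φ n (fun t => (derivative H).eval (t : ℂ)) with hJn
  have hrec : ∀ n : ℕ, 1 ≤ n → Jn (n + 1) - (1 - ((κ : ℝ) : ℂ) / n) * Jn n =
      κ * (φ π ^ n * H.eval ((π : ℝ) : ℂ) - φ (-π) ^ n * H.eval (((-π : ℝ)) : ℂ)) * (1 / n : ℂ) -
        J φ (n - 1) E := by
    intro n hn
    have hn0 : (n : ℂ) ≠ 0 := by exact_mod_cast (by omega : n ≠ 0)
    have hE' : J φ (n - 1) E = Jn n - Jn (n + 1) +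
        κ * J φ (n - 1) (fun t => φ' t * H.eval (t : ℂ)) := by
      simp only [hJn]
      rw [← J_const_mul]
      simp only [J]
      rw [← intervalIntegral.integral_sub, ← intervalIntegral.integral_add]
      · congr 1; ext t
        obtain ⟨m, rfl⟩ : ∃ m, n = m + 1 := ⟨n - 1, by omega⟩
        simp only [hE, Nat.add_sub_cancel]
        ring
      all_goals exact Continuous.intervalIntegrable (by fun_prop) _ _
    rw [hE', ← h.integral_by_parts H n]
    simp only [hJn]
    field_simp
    ring
  have hsmall : (fun n => Jn (n + 1) - (1 - ((κ : ℝ) : ℂ) / n) * Jn n) =O[posNat]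
      fun n : ℕ => (n : ℝ) ^ (-1 - (((r : ℝ) + 2) / 2)) := by
    have e1 := (h.isBigO_boundary (fun t => H.eval (t : ℂ)) (1 + (((r : ℝ) + 2) / 2))).const_mul_left
      (κ : ℂ)
    have e1' : (fun n : ℕ => (1 / n : ℂ)) =O[posNat] fun _ => (1 : ℝ) := by
      rw [isBigO_principal]
      refine ⟨1, fun n hn => ?_⟩
      have hn : 1 ≤ n := hn
      have hn1 : (1 : ℝ) ≤ n := by exact_mod_cast hn
      simpa using inv_le_one_of_one_le₀ hn1
    have e2 := h.isBigO_integral_pred hEO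
    have e3 := (e1.mul e1').congr_right (g₂ := fun n : ℕ => (n : ℝ) ^ (-1 - (((r : ℝ) + 2) / 2)))
      fun n => by rw [mul_one]; congr 1; ring
    have e4 := e2.congr_right (g₂ := fun n : ℕ => (n : ℝ) ^ (-1 - (((r : ℝ) + 2) / 2)))
      fun n => by congr 1; push_cast; ring
    exact (e3.sub e4).congr' (eventually_principal.2 fun n hn => (hrec n hn).symm)
      EventuallyEq.rfl
  obtain ⟨K, hK⟩ := isBigO_principal.1 hsmall
  have hkr : ((2 * k : ℕ) : ℝ) ≤ r := by exact_mod_cast hk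
  obtain ⟨R, C', hR⟩ := exists_multiple_of_recurrence k Jn (((r : ℝ) + 2) / 2) K
    (by push_cast at hkr; linarith) (fun n hn => by
      have := hK n hn
      rwa [Real.norm_of_nonneg (by positivity)] at this)
  refine ⟨G, R, isBigO_principal.2 ⟨C', fun n hn => ?_⟩⟩
  rw [Real.norm_of_nonneg (by positivity)]
  exact hR n hn

lemma isBigO_integral_exact (i : ℕ) (s : ℝ) (hs : 0 ≤ s) :
    (fun n => J φ n (fun t => φ' t * (1 - φ t) ^ i)) =O[posNat]
      fun n : ℕ => (n : ℝ) ^ (-s) := by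
  have hφ := h.continuous
  have hφ' := h.continuous_deriv
  have hstep : ∀ f : ℕ → ℂ, f =O[posNat] (fun n : ℕ => (n : ℝ) ^ (-s)) →
      (fun n => f (n + 1)) =O[posNat] (fun n : ℕ => (n : ℝ) ^ (-s)) := by
    intro f hf
    obtain ⟨K, hK⟩ := isBigO_principal.1 hf
    refine isBigO_principal.2 ⟨|K|, fun n hn => ?_⟩
    have hn : 1 ≤ n := hn
    have hn0 : (0 : ℝ) < n := by exact_mod_cast hn
    refine (hK (n + 1) (by simp)).trans ?_
    rw [Real.norm_of_nonneg (by positivity), Real.norm_of_nonneg (by positivity)]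
    refine mul_le_mul (le_abs_self K) ?_ (by positivity) (abs_nonneg K)
    exact Real.rpow_le_rpow_of_nonpos hn0 (by push_cast; linarith) (by linarith)
  induction i with
  | zero =>
    have h1 := hstep _ (h.isBigO_boundary (fun _ => 1) s)
    have h2 : (fun n : ℕ => (1 / ((n : ℂ) + 1))) =O[posNat] fun _ => (1 : ℝ) := by
      refine isBigO_principal.2 ⟨1, fun n _ => ?_⟩
      have : ‖(n : ℂ) + 1‖ = (n : ℝ) + 1 := by
        rw [← Nat.cast_add_one, Complex.norm_natCast]; push_cast; rfl
      rw [norm_div, this, norm_one, norm_one, mul_one, div_le_one (by positivity)]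
      linarith [Nat.cast_nonneg (α := ℝ) n]
    refine (h1.mul h2).congr (fun n => ?_) fun n => mul_one _
    have hn : (n : ℂ) + 1 ≠ 0 := by exact_mod_cast Nat.succ_ne_zero n
    have hd : ∀ t ∈ Set.uIcc (-π) π, HasDerivAt (fun t : ℝ => φ t ^ (n + 1) * (1 / ((n : ℂ) + 1)))
        (φ t ^ n * (φ' t * (1 - φ t) ^ 0)) t := by
      intro t _
      refine (((h.hasDerivAt t).pow (n + 1)).mul_const _).congr_deriv ?_
      simp only [Nat.add_sub_cancel]
      push_cast
      field_simp
    rw [J, intervalIntegral.integral_eq_sub_of_hasDerivAt hd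
      (Continuous.intervalIntegrable (by fun_prop) _ _)]
    ring
  | succ i ih =>
    refine (ih.sub (hstep _ ih)).congr_left fun n => ?_
    rw [J, J, J, ← intervalIntegral.integral_sub]
    · congr 1; ext t; ring
    all_goals exact Continuous.intervalIntegrable (by fun_prop) _ _

/-- The polynomials `T' (1 - T) ^ i`, of odd order of vanishing `2 i + 1`, contribute nothing to
the expansion: `φ ^ n φ' (1 - φ) ^ i` is an exact derivative. -/
lemma isBigO_integral_odd_element (i : ℕ) :
    (fun n => J φ n (fun t => (derivative T * (1 - T) ^ i).eval (t : ℂ))) =O[posNat]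
      fun n : ℕ => (n : ℝ) ^ (-(((r : ℝ) + 2) / 2)) := by
  have hφ := h.continuous
  have hφ' := h.continuous_deriv
  have hTc := continuous_eval_ofReal T
  have hdiff : ∀ i : ℕ, (fun t : ℝ => (derivative T * (1 - T) ^ i).eval (t : ℂ) -
      φ' t * (1 - φ t) ^ i) =O[period] fun t => t ^ (r + 2) := by
    intro i
    induction i with
    | zero =>
      refine h.taylor_deriv.neg_left.congr_left fun t => ?_
      simp
    | succ i ih =>
      have e1 := isBigO_mul_continuous ih (G := fun t : ℝ => 1 - T.eval (t : ℂ)) (by fun_prop)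
      have e2 := (isBigO_mul_continuous h.taylor (G := fun t => φ' t * (1 - φ t) ^ i)
        (by fun_prop)).trans (isBigO_pow_of_le (show r + 2 ≤ r + 3 by omega))
      refine (e1.add e2).congr_left fun t => ?_
      simp only [eval_mul, eval_pow, eval_sub, eval_one]
      ring
  have e1 := h.isBigO_integral ((hdiff i).trans (isBigO_pow_of_le (show r + 1 ≤ r + 2 by omega)))
  have e2 := h.isBigO_integral_exact i (((r : ℝ) + 2) / 2) (by positivity)
  have e3 := e1.congr_right (g₂ := fun n : ℕ => (n : ℝ) ^ (-(((r : ℝ) + 2) / 2)))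
    fun n => by congr 1; push_cast; ring
  refine (e3.add e2).congr_left fun n => ?_
  rw [J_sub hφ (continuous_eval_ofReal _) (by fun_prop)]
  ring

end IsGaussianLike

end

lemma exists_pow_succ_dvd_sub {g p : ℂ[X]} {m : ℕ} (hg : X ^ m ∣ g) (hp : p.coeff 0 ≠ 0) :
    ∃ b : ℂ, X ^ (m + 1) ∣ g - C b * (X ^ m * p) := by
  obtain ⟨q, rfl⟩ := hg
  refine ⟨q.coeff 0 / p.coeff 0, ?_⟩
  have h1 : X ∣ q - C (q.coeff 0 / p.coeff 0) * p := by
    rw [X_dvd_iff, coeff_sub, coeff_C_mul, div_mul_cancel₀ _ hp, sub_self]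
  rw [pow_succ, show X ^ m * q - C (q.coeff 0 / p.coeff 0) * (X ^ m * p) =
    X ^ m * (q - C (q.coeff 0 / p.coeff 0) * p) by ring]
  exact mul_dvd_mul_left _ h1

lemma norm_pow_succ_sub_pow_succ_le {x y : ℂ} {b : ℝ} (hx : ‖x‖ ≤ b) (hy : ‖y‖ ≤ b) (n : ℕ) :
    ‖x ^ (n + 1) - y ^ (n + 1)‖ ≤ (n + 1) * ‖x - y‖ * b ^ n := by
  have hb : 0 ≤ b := (norm_nonneg _).trans hx
  induction n with
  | zero => simp
  | succ n ih =>
    have h1 : x ^ (n + 1 + 1) - y ^ (n + 1 + 1) =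
        x * (x ^ (n + 1) - y ^ (n + 1)) + (x - y) * y ^ (n + 1) := by ring
    rw [h1]
    calc _ ≤ ‖x‖ * ‖x ^ (n + 1) - y ^ (n + 1)‖ + ‖x - y‖ * ‖y‖ ^ (n + 1) := by
          refine (norm_add_le _ _).trans_eq ?_
          rw [norm_mul, norm_mul, norm_pow]
      _ ≤ b * ((n + 1) * ‖x - y‖ * b ^ n) + ‖x - y‖ * b ^ (n + 1) := by gcongr
      _ = _ := by push_cast; ring

/-- Taylor's formula for `exp (i x)`, with a remainder bounded uniformly on the real line. -/
lemma exists_norm_exp_sub_taylor_le (m : ℕ) : ∃ K : ℝ, 0 ≤ K ∧ ∀ x : ℝ,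
    ‖Complex.exp (x * Complex.I) -
      ∑ l ∈ Finset.range m, (x * Complex.I) ^ l / (l.factorial : ℂ)‖ ≤ K * |x| ^ m := by
  refine ⟨Real.exp 1 + (1 + m), by positivity, fun x => ?_⟩
  have hn : ‖(x : ℂ) * Complex.I‖ = |x| := by simp
  rcases le_total |x| 1 with hx | hx
  · refine (Complex.norm_exp_sub_sum_le_norm_mul_exp _ m).trans ?_
    rw [hn, mul_comm]
    gcongr
    have := Real.exp_le_exp.2 hx
    have h2 : (0 : ℝ) ≤ 1 + m := by positivity
    linarith
  · have h1 : ‖Complex.exp (x * Complex.I)‖ = 1 := Complex.norm_exp_ofReal_mul_I x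
    have h2 : ‖∑ l ∈ Finset.range m, (x * Complex.I) ^ l / (l.factorial : ℂ)‖ ≤ m * |x| ^ m := by
      refine (norm_sum_le_of_le (Finset.range m) (f := fun l => ((x : ℂ) * Complex.I) ^ l / (l.factorial : ℂ))
        (n := fun _ => |x| ^ m) fun l hl => ?_).trans_eq (by simp)
      rw [norm_div, norm_pow, hn, Complex.norm_natCast]
      have h3 : (1 : ℝ) ≤ l.factorial := by exact_mod_cast Nat.one_le_iff_ne_zero.2 l.factorial_ne_zero
      calc |x| ^ l / (l.factorial : ℝ) ≤ |x| ^ l := div_le_self (by positivity) h3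
        _ ≤ |x| ^ m := pow_le_pow_right₀ hx (Finset.mem_range.1 hl).le
    have h4 : 1 ≤ |x| ^ m := one_le_pow₀ hx
    calc _ ≤ 1 + m * |x| ^ m := (norm_sub_le _ _).trans (by rw [h1]; gcongr)
      _ ≤ _ := by
        have h5 : 0 ≤ Real.exp 1 * |x| ^ m := by positivity
        nlinarith

namespace IsGaussianLike

variable {r : ℕ} {φ φ' : ℝ → ℂ} {T : ℂ[X]} {v c : ℝ} (h : IsGaussianLike r φ φ' T v c)

include h

/-- Every polynomial `g` has an expansion, which starts no earlier than the order of vanishing of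
`g` at `0` suggests. Downward induction on this order: the even orders are removed with
`exists_even_element`, the odd ones with `isBigO_integral_odd_element`. -/
lemma exists_hasExpansion {m : ℕ} (hm : m ≤ r + 1) {g : ℂ[X]} (hg : X ^ m ∣ g) :
    ∃ d : ℕ → ℂ, (∀ k, 2 * k < m → d k = 0) ∧ HasExpansion r φ (fun t => g.eval (t : ℂ)) d := by
  obtain ⟨e, he⟩ : ∃ e, m + e = r + 1 := ⟨r + 1 - m, by omega⟩
  clear hm
  have hφ := h.continuous
  induction e generalizing m g with
  | zero =>
    refine ⟨0, fun _ _ => rfl, ?_⟩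
    refine (h.isBigO_integral (isBigO_eval_of_dvd hg)).congr (fun n => by simp) fun n => ?_
    congr 1
    have : (m : ℝ) = r + 1 := by exact_mod_cast he
    rw [this]; ring
  | succ e ih =>
    suffices hs : ∃ (p : ℂ[X]) (d : ℕ → ℂ), p.coeff 0 ≠ 0 ∧ (∀ k, 2 * k < m → d k = 0) ∧
        HasExpansion r φ (fun t => (X ^ m * p).eval (t : ℂ)) d by
      obtain ⟨p, d, hp, hd, hpd⟩ := hs
      obtain ⟨b, hb⟩ := exists_pow_succ_dvd_sub hg hp
      obtain ⟨d', hd', hgd⟩ := ih hb (by omega)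
      refine ⟨fun k => d' k + b * d k, fun k hk => ?_, ?_⟩
      · simp [hd' k (by omega), hd k hk]
      · have := hgd.add hφ (continuous_eval_ofReal _) ((continuous_eval_ofReal _).const_mul b)
          (hpd.const_mul b)
        have heq : (fun t : ℝ => (g - C b * (X ^ m * p)).eval (t : ℂ) +
            b * (X ^ m * p).eval (t : ℂ)) = fun t : ℝ => g.eval (t : ℂ) := by
          ext t
          rw [eval_sub, eval_mul (p := C b), eval_C]
          ring
        rwa [heq] at this
    rcases Nat.even_or_odd' m with ⟨k, rfl | rfl⟩
    · obtain ⟨G, R, hR⟩ := h.exists_even_element (k := k) (by omega)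
      have hder : derivative (X ^ (2 * k + 1) + X ^ (2 * k + 2) * G) = X ^ (2 * k) *
          (C (((2 * k + 1 : ℕ) : ℂ)) + X * (C (((2 * k + 2 : ℕ) : ℂ)) * G + X * derivative G)) := by
        rw [derivative_add, derivative_mul, derivative_X_pow, derivative_X_pow,
          Nat.add_sub_cancel, show 2 * k + 2 - 1 = 2 * k + 1 by omega]
        ring
      refine ⟨C (((2 * k + 1 : ℕ) : ℂ)) + X * (C (((2 * k + 2 : ℕ) : ℂ)) * G + X * derivative G),
        Pi.single k R, ?_, fun j hj => by
          rw [Pi.single_eq_of_ne (show j ≠ k by omega)], ?_⟩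
      swap
      · rw [← hder]
        refine hR.congr_left fun n => ?_
        rw [Finset.sum_eq_single_of_mem k (Finset.mem_range.2 (by omega)) fun j _ hj => by
          rw [Pi.single_eq_of_ne hj, zero_mul], Pi.single_eq_same]
      · rw [coeff_add, coeff_C_zero, coeff_X_mul_zero, add_zero]
        exact_mod_cast Nat.succ_ne_zero (2 * k)
    · obtain ⟨u, hu⟩ := h.poly
      have hT' := derivative_eq_of_eq_one_sub hu
      have hodd : derivative T * (1 - T) ^ k = X ^ (2 * k + 1) *
          ((-2 * C (v : ℂ) + X * (-3 * u - X * derivative u)) * (C (v : ℂ) + X * u) ^ k) := by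
        rw [hT', show 1 - T = X ^ 2 * (C (v : ℂ) + X * u) by rw [hu]; ring, mul_pow, ← pow_mul]
        ring
      refine ⟨(-2 * C (v : ℂ) + X * (-3 * u - X * derivative u)) * (C (v : ℂ) + X * u) ^ k,
        0, ?_, fun _ _ => rfl, ?_⟩
      swap
      · rw [← hodd]
        refine (h.isBigO_integral_odd_element k).congr_left fun n => ?_
        simp
      · rw [coeff_zero_eq_eval_zero]
        have hv := (h.pos.trans_le h.le).ne'
        simp [hv]

lemma isBigO_sub_exp :
    (fun t : ℝ => φ t - Real.exp (-v * t ^ 2)) =O[period] fun t => t ^ 3 := by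
  obtain ⟨u, hu⟩ := h.poly
  have e1 := h.taylor.trans (isBigO_pow_of_le (show 3 ≤ r + 3 by omega))
  have e2 := isBigO_eval_of_dvd (g := X ^ 3 * (-u)) (m := 3) ⟨_, rfl⟩
  have e3 : (fun t : ℝ => (Real.exp (-v * t ^ 2) : ℂ) - (1 - v * t ^ 2)) =O[period]
      fun t => t ^ 3 := by
    refine IsBigO.trans ?_ (isBigO_pow_of_le (show 3 ≤ 4 by omega))
    refine isBigO_principal.2 ⟨v ^ 2 * Real.exp (v * π ^ 2), fun t ht => ?_⟩
    have hv : 0 < v := h.pos.trans_le h.le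
    have h1 := Complex.norm_exp_sub_sum_le_norm_mul_exp ((-v * t ^ 2 : ℝ) : ℂ) 2
    have h2 : ‖((-v * t ^ 2 : ℝ) : ℂ)‖ = v * t ^ 2 := by
      rw [Complex.norm_real, Real.norm_eq_abs, neg_mul, abs_neg, abs_of_nonneg (by positivity)]
    have h3 : t ^ 2 ≤ π ^ 2 := sq_le_sq' ht.1 ht.2
    rw [h2] at h1
    simp only [Finset.sum_range_succ, Finset.range_zero, Finset.sum_empty, pow_zero,
      Nat.factorial_zero, Nat.factorial_one, pow_one, Nat.cast_one, div_one, zero_add] at h1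
    have h4 : (Real.exp (-v * t ^ 2) : ℂ) - (1 - v * t ^ 2) =
        Complex.exp ((-v * t ^ 2 : ℝ) : ℂ) - (1 + ((-v * t ^ 2 : ℝ) : ℂ)) := by
      push_cast; ring
    rw [h4]
    refine h1.trans ?_
    have h5 : Real.exp (v * t ^ 2) ≤ Real.exp (v * π ^ 2) := by gcongr
    have h6 : ‖t ^ 4‖ = t ^ 4 := Real.norm_of_nonneg (by positivity)
    rw [h6]
    calc _ ≤ (v * t ^ 2) ^ 2 * Real.exp (v * π ^ 2) := by gcongr
      _ = _ := by ring
  refine ((e1.add e2).sub e3).congr_left fun t => ?_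
  rw [hu]
  simp only [eval_sub, eval_one, eval_mul, eval_pow, eval_X, eval_add, eval_C, eval_neg]
  ring

lemma isBigO_integral_sub_gaussian (m : ℕ) :
    (fun n => J φ n (fun t => (t : ℂ) ^ m) -
      ((∫ t in (-π)..π, Real.exp (-(v * n) * t ^ 2) * t ^ m : ℝ) : ℂ)) =O[posNat]
      fun n : ℕ => (n : ℝ) ^ (-(((m : ℝ) + 2) / 2)) := by
  have hφ := h.continuous
  obtain ⟨K, hK⟩ := isBigO_principal.1 h.isBigO_sub_exp
  have key := isBigO_integral_of_le_gaussian c h.pos (m + 3) (K * Real.exp (c * π ^ 2))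
    (fun n t => (1 / n : ℂ) * (φ t ^ n - (Real.exp (-v * t ^ 2) : ℂ) ^ n) * (t : ℂ) ^ m) (by
      intro n hn t ht
      obtain ⟨N, rfl⟩ : ∃ N, n = N + 1 := ⟨n - 1, by omega⟩
      have hle : ‖(Real.exp (-v * t ^ 2) : ℂ)‖ ≤ Real.exp (-c * t ^ 2) := by
        rw [Complex.norm_real, Real.norm_of_nonneg (Real.exp_pos _).le]
        exact Real.exp_le_exp.2 (by nlinarith [h.le, sq_nonneg t])
      have h1 := norm_pow_succ_sub_pow_succ_le (h.norm_le t ht) hle N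
      have h2 := h.norm_pow_pred_le hn ht
      rw [Nat.add_sub_cancel] at h2
      have h3 := hK t ht
      rw [norm_pow, Real.norm_eq_abs] at h3
      have hN : (0 : ℝ) < N + 1 := by positivity
      have hKN := mul_nonneg hN.le ((norm_nonneg _).trans h3)
      have h0 : ‖(1 / ((N + 1 : ℕ) : ℂ))‖ = 1 / ((N : ℝ) + 1) := by
        rw [norm_div, norm_one, Complex.norm_natCast]; push_cast; rfl
      rw [norm_mul, norm_mul, h0, norm_pow, Complex.norm_real, Real.norm_eq_abs]
      calc _ ≤ 1 / ((N : ℝ) + 1) * ((N + 1) * (K * |t| ^ 3) *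
            (Real.exp (c * π ^ 2) * Real.exp (-(c * (N + 1 : ℕ)) * t ^ 2))) * |t| ^ m := by
            gcongr
            refine h1.trans ?_
            gcongr
        _ = _ := by field_simp; ring)
  have hn : (fun n : ℕ => (n : ℂ)) =O[posNat] fun n : ℕ => (n : ℝ) :=
    isBigO_of_le _ fun n => by simp
  refine (hn.mul key).congr' ?_ ?_
  · refine eventually_principal.2 fun n hn => ?_
    have hn : 1 ≤ n := hn
    have hn0 : (n : ℂ) ≠ 0 := by exact_mod_cast (by omega : n ≠ 0)
    beta_reduce
    rw [← intervalIntegral.integral_ofReal, J, ← intervalIntegral.integral_sub,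
      ← intervalIntegral.integral_const_mul]
    · congr 1; ext t
      have : ((Real.exp (-v * t ^ 2) : ℂ)) ^ n = (Real.exp (-(v * n) * t ^ 2) : ℂ) := by
        norm_cast
        rw [← Real.exp_nat_mul]; congr 1; ring
      rw [this]
      push_cast
      field_simp
    all_goals exact Continuous.intervalIntegrable (by fun_prop) _ _
  · refine eventually_principal.2 fun n hn => ?_
    have hn : 1 ≤ n := hn
    have hn0 : (0 : ℝ) < n := by exact_mod_cast hn
    beta_reduce
    rw [← Real.rpow_one_add' hn0.le]
    · congr 1; push_cast; ring
    · push_cast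
      have : (0 : ℝ) ≤ m := Nat.cast_nonneg m
      intro h0; linarith

omit h in
lemma le_integral_gaussian (hv : 0 < v) (k n : ℕ) (hn : 1 ≤ n) :
    Real.exp (-v) / (2 * k + 1) * (n : ℝ) ^ (-((k : ℝ) + 1 / 2)) ≤
      ∫ t in (-π)..π, Real.exp (-(v * n) * t ^ 2) * t ^ (2 * k) := by
  have hn0 : (0 : ℝ) < n := by exact_mod_cast hn
  have hn1 : (1 : ℝ) ≤ n := by exact_mod_cast hn
  set b : ℝ := (n : ℝ) ^ (-(1 / 2 : ℝ)) with hb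
  have hb0 : 0 ≤ b := by positivity
  have hb1 : b ≤ 1 := Real.rpow_le_one_of_one_le_of_nonpos hn1 (by norm_num)
  have hbsq : b ^ 2 = (n : ℝ)⁻¹ := by
    rw [hb, ← Real.rpow_natCast, ← Real.rpow_mul hn0.le, ← Real.rpow_neg_one]; norm_num
  have h1 : ∫ t in (0 : ℝ)..b, Real.exp (-v) * t ^ (2 * k) =
      Real.exp (-v) / (2 * k + 1) * (n : ℝ) ^ (-((k : ℝ) + 1 / 2)) := by
    rw [intervalIntegral.integral_const_mul, integral_pow]
    have h2 : b ^ (2 * k + 1) = (n : ℝ) ^ (-((k : ℝ) + 1 / 2)) := by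
      rw [hb, ← Real.rpow_natCast, ← Real.rpow_mul hn0.le]; congr 1; push_cast; ring
    rw [h2]
    push_cast
    simp
    ring
  rw [← h1]
  calc _ ≤ ∫ t in (0 : ℝ)..b, Real.exp (-(v * n) * t ^ 2) * t ^ (2 * k) := by
        refine intervalIntegral.integral_mono_on hb0
          (Continuous.intervalIntegrable (by fun_prop) _ _)
          (Continuous.intervalIntegrable (by fun_prop) _ _) fun t ht => ?_
        have h3 : t ^ 2 ≤ (n : ℝ)⁻¹ := hbsq ▸ pow_le_pow_left₀ ht.1 ht.2 2
        have h4 : n * t ^ 2 ≤ 1 := by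
          calc n * t ^ 2 ≤ n * (n : ℝ)⁻¹ := by gcongr
            _ = 1 := mul_inv_cancel₀ hn0.ne'
        have h5 := mul_le_mul_of_nonneg_left h4 hv.le
        have h6 : Real.exp (-v) ≤ Real.exp (-(v * n) * t ^ 2) := Real.exp_le_exp.2 (by linarith)
        exact mul_le_mul_of_nonneg_right h6 (by rw [pow_mul]; positivity)
    _ ≤ _ := by
        refine intervalIntegral.integral_mono_interval (by linarith [Real.pi_pos]) hb0
          (by linarith [Real.pi_gt_three]) (ae_of_all _ fun t => ?_)
          (Continuous.intervalIntegrable (by fun_prop) _ _)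
        simp only [Pi.zero_apply]
        rw [pow_mul t 2 k]; positivity

/-- The leading coefficient of the expansion of `t ^ (2 k)` does not vanish, since the integral is
asymptotic to a positive Gaussian moment. -/
lemma re_leading_coeff_ne_zero {k : ℕ} (hk : 2 * k ≤ r) {d : ℕ → ℂ}
    (hd : ∀ j, 2 * j < 2 * k → d j = 0)
    (hexp : HasExpansion r φ (fun t => (t : ℂ) ^ (2 * k)) d) : (d k).re ≠ 0 := by
  intro hzero
  have hv : 0 < v := h.pos.trans_le h.le
  have hrest : (fun n => ∑ j ∈ Finset.range (r / 2 + 1), d j * (a (j + 1) (n - 1) : ℝ) -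
      d k * (a (k + 1) (n - 1) : ℝ)) =O[posNat] fun n : ℕ => (n : ℝ) ^ (-((k : ℝ) + 1)) := by
    have h1 : ∀ j ∈ (Finset.range (r / 2 + 1)).erase k,
        (fun n => d j * ((a (j + 1) (n - 1) : ℝ) : ℂ)) =O[posNat]
          fun n : ℕ => (n : ℝ) ^ (-((k : ℝ) + 1)) := by
      intro j hj
      rcases lt_or_ge j k with hjk | hjk
      · rw [hd j (by omega)]
        simpa using isBigO_zero _ _
      · have hlt : k + 1 ≤ j := by have := Finset.ne_of_mem_erase hj; omega
        have hlt' : (k : ℝ) + 1 ≤ j := by exact_mod_cast hlt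
        refine (IsBigO.trans ?_ (isBigO_rpow_of_le (show (k : ℝ) + 1 ≤ (j : ℝ) + 1 / 2 by
          linarith))).const_mul_left _
        obtain ⟨c₁, c₂, -, -, hb⟩ := exists_bounds_a j
        refine isBigO_principal.2 ⟨c₂, fun n hn => ?_⟩
        rw [Complex.norm_real, Real.norm_of_nonneg (show 0 ≤ (n : ℝ) ^ (-((j : ℝ) + 1 / 2)) by positivity)]
        exact (hb n hn).2
    refine (IsBigO.sum h1).congr_left fun n => ?_
    rw [Finset.sum_apply, ← Finset.add_sum_erase _ _ (Finset.mem_range.2 (by omega : k < r / 2 + 1))]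
    ring
  have hkr : ((2 * k : ℕ) : ℝ) ≤ r := by exact_mod_cast hk
  push_cast at hkr
  have e1 := hexp.trans (isBigO_rpow_of_le (show (k : ℝ) + 1 ≤ ((r : ℝ) + 2) / 2 by linarith))
  have e2 := (h.isBigO_integral_sub_gaussian (2 * k)).congr_right
    (g₂ := fun n : ℕ => (n : ℝ) ^ (-((k : ℝ) + 1))) fun n => by congr 1; push_cast; ring
  have e3 := (e1.add hrest).sub e2
  obtain ⟨K, hK⟩ := isBigO_principal.1 e3
  set κ := Real.exp (-v) / (2 * k + 1) with hκ
  have hκ0 : 0 < κ := by positivity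
  -- if `Re (d k) = 0`, the Gaussian integral, of order `n ^ (-k - 1/2)`, would be `O(n ^ (-k - 1))`
  have hbound : ∀ n : ℕ, 1 ≤ n → κ * (n : ℝ) ^ (1 / 2 : ℝ) ≤ K := by
    intro n hn
    have hn0 : (0 : ℝ) < n := by exact_mod_cast hn
    have h1 := (Complex.abs_re_le_norm _).trans (hK n hn)
    have h2 := le_integral_gaussian hv k n hn
    set I := ∫ t in (-π)..π, Real.exp (-(v * n) * t ^ 2) * t ^ (2 * k)
    have h3 : (J φ n (fun t => (t : ℂ) ^ (2 * k)) -
        ∑ j ∈ Finset.range (r / 2 + 1), d j * (a (j + 1) (n - 1) : ℝ) +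
        (∑ j ∈ Finset.range (r / 2 + 1), d j * (a (j + 1) (n - 1) : ℝ) -
          d k * (a (k + 1) (n - 1) : ℝ)) -
        (J φ n (fun t => (t : ℂ) ^ (2 * k)) - (I : ℂ))).re = I := by
      rw [show ∀ x y z w : ℂ, x - y + (y - z) - (x - w) = w - z by intros; ring]
      rw [Complex.sub_re, Complex.re_mul_ofReal, hzero]; simp
    rw [h3, Real.norm_of_nonneg (by positivity)] at h1
    have h4 : κ * (n : ℝ) ^ (-((k : ℝ) + 1 / 2)) ≤ K * (n : ℝ) ^ (-((k : ℝ) + 1)) :=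
      h2.trans ((le_abs_self I).trans h1)
    rw [show -((k : ℝ) + 1 / 2) = 1 / 2 + -((k : ℝ) + 1) by ring, Real.rpow_add hn0,
      ← mul_assoc] at h4
    exact le_of_mul_le_mul_right h4 (by positivity)
  have hlim := ((tendsto_rpow_atTop (show (0 : ℝ) < 1 / 2 by norm_num)).comp
    tendsto_natCast_atTop_atTop).const_mul_atTop hκ0
  obtain ⟨n, hn1, hn2⟩ := ((hlim.eventually_gt_atTop K).and (eventually_ge_atTop 1)).exists
  exact absurd (hbound n hn2) (not_le.2 hn1)

/-- The local expansion: the Fourier coefficients of `φ ^ n` are approximated by polynomials in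
`y` times the sequences `a_{n-1}^{(k+1)}`. -/
theorem exists_local_expansion :
    ∃ θ : ℕ → ℝ[X],
      (∀ k ∈ Finset.range (r / 2 + 1), (θ k).degree = ((2 * k : ℕ) : WithBot ℕ)) ∧
      ∃ C : ℝ, ∀ n : ℕ, 1 ≤ n → ∀ y : ℝ,
        |(((2 * π)⁻¹ : ℂ) * J φ n (fun t => Complex.exp ((-(t * y) : ℝ) * Complex.I))).re -
            ∑ k ∈ Finset.range (r / 2 + 1), (θ k).eval y * a (k + 1) (n - 1)| ≤
          C * (1 + |y|) ^ (r + 1) * (n : ℝ) ^ (-(((r : ℝ) + 2) / 2)) := by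
  have hφ := h.continuous
  have hex : ∀ l : ℕ, ∃ d : ℕ → ℂ, l ≤ r → (∀ k, 2 * k < l → d k = 0) ∧
      HasExpansion r φ (fun t => (t : ℂ) ^ l) d := by
    intro l
    by_cases hl : l ≤ r
    · obtain ⟨d, hd, hd'⟩ := h.exists_hasExpansion (m := l) (by omega) (dvd_refl (X ^ l))
      exact ⟨d, fun _ => ⟨hd, by simpa using hd'⟩⟩
    · exact ⟨0, fun h => absurd h hl⟩
  choose d hd using hex
  have hbd : ∀ l : ℕ, ∃ B : ℝ, l ≤ r → ∀ n : ℕ, 1 ≤ n →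
      ‖J φ n (fun t => (t : ℂ) ^ l) - ∑ k ∈ Finset.range (r / 2 + 1), d l k *
        (a (k + 1) (n - 1) : ℝ)‖ ≤ B * (n : ℝ) ^ (-(((r : ℝ) + 2) / 2)) := by
    intro l
    by_cases hl : l ≤ r
    · obtain ⟨B, hB⟩ := isBigO_principal.1 (hd l hl).2
      refine ⟨B, fun _ n hn => ?_⟩
      have := hB n hn
      rwa [Real.norm_of_nonneg (by positivity)] at this
    · exact ⟨0, fun h => absurd h hl⟩
  choose B hB using hbd
  set e : ℕ → ℂ := fun l => ((2 * π)⁻¹ : ℂ) * ((-Complex.I) ^ l / (l.factorial : ℂ)) with he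
  set θ : ℕ → ℝ[X] := fun k => ∑ l ∈ Finset.range (r + 1), monomial l ((e l * d l k).re) with hθ
  -- the real parts suffice because the left hand side and the `a (k + 1) n` are real
  have hcoeff : ∀ k l, (θ k).coeff l = if l ≤ r then (e l * d l k).re else 0 := by
    intro k l
    simp only [hθ, finsetSum_coeff, coeff_monomial, Finset.sum_ite_eq', Finset.mem_range,
      Nat.lt_succ_iff]
  refine ⟨θ, fun k hk => ?_, ?_⟩
  · have hk' : 2 * k ≤ r := by have := Finset.mem_range.1 hk; omega
    refine degree_eq_of_le_of_coeff_ne_zero ?_ ?_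
    · rw [degree_le_iff_coeff_zero]
      intro l hl
      have hl : 2 * k < l := by exact_mod_cast hl
      rw [hcoeff]
      split_ifs with hlr
      · rw [(hd l hlr).1 k hl]; simp
      · rfl
    · rw [hcoeff, if_pos hk']
      have hlead := h.re_leading_coeff_ne_zero hk' (hd (2 * k) hk').1 (hd (2 * k) hk').2
      have hek : e (2 * k) = (((2 * π)⁻¹ * ((-1) ^ k / ((2 * k).factorial : ℝ)) : ℝ) : ℂ) := by
        simp only [he, pow_mul, neg_sq, Complex.I_sq]
        push_cast; ring
      rw [hek, Complex.re_ofReal_mul]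
      refine mul_ne_zero (mul_ne_zero (by positivity) (div_ne_zero ?_ ?_)) hlead
      · exact pow_ne_zero _ (by norm_num)
      · exact_mod_cast Nat.factorial_ne_zero _
  obtain ⟨K, hK0, hK⟩ := exists_norm_exp_sub_taylor_le (r + 1)
  obtain ⟨M, hM0, hM⟩ := integral_gaussian_moment_le c h.pos (r + 1)
  refine ⟨‖((2 * π)⁻¹ : ℂ)‖ * (K * (Real.exp (c * π ^ 2) * M)) +
    ∑ l ∈ Finset.range (r + 1), ‖e l‖ * |B l|, fun n hn y => ?_⟩
  have hy1 : (1 : ℝ) ≤ 1 + |y| := by linarith [abs_nonneg y]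
  set N : ℝ := (n : ℝ) ^ (-(((r : ℝ) + 2) / 2)) with hN
  have hN0 : 0 ≤ N := by positivity
  set ρ : ℝ → ℂ := fun t => Complex.exp ((-(t * y) : ℝ) * Complex.I) -
    ∑ l ∈ Finset.range (r + 1), ((-(t * y) : ℝ) * Complex.I) ^ l / (l.factorial : ℂ) with hρ
  have hρc : Continuous ρ := by simp only [hρ]; fun_prop
  have hρn : ‖J φ n ρ‖ ≤ K * (Real.exp (c * π ^ 2) * M) * (1 + |y|) ^ (r + 1) * N := by
    have h1 : ‖J φ n ρ‖ ≤ ∫ t in (-π)..π, (K * |y| ^ (r + 1) * Real.exp (c * π ^ 2)) *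
        (Real.exp (-(c * n) * t ^ 2) * |t| ^ (r + 1)) := by
      refine intervalIntegral.norm_integral_le_of_norm_le (by linarith [Real.pi_pos])
          (ae_of_all _ fun t ht => ?_) (Continuous.intervalIntegrable (by fun_prop) _ _)
      have ht := Set.Ioc_subset_Icc_self ht
      have h2 : ‖φ t‖ ^ n ≤ Real.exp (c * π ^ 2) * Real.exp (-(c * n) * t ^ 2) := by
        have hle : ‖φ t‖ ≤ 1 := (h.norm_le t ht).trans
          (Real.exp_le_one_iff.2 (by nlinarith [h.pos, sq_nonneg t]))
        calc ‖φ t‖ ^ n ≤ ‖φ t‖ ^ (n - 1) :=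
              pow_le_pow_of_le_one (norm_nonneg _) hle (Nat.sub_le _ _)
          _ ≤ _ := (pow_le_pow_left₀ (norm_nonneg _) (h.norm_le t ht) _).trans
              (h.norm_pow_pred_le hn ht)
      have h3 := hK (-(t * y))
      rw [abs_neg, abs_mul, mul_pow] at h3
      rw [norm_mul, norm_pow]
      calc _ ≤ (Real.exp (c * π ^ 2) * Real.exp (-(c * n) * t ^ 2)) *
            (K * (|t| ^ (r + 1) * |y| ^ (r + 1))) := mul_le_mul h2 h3 (norm_nonneg _) (by positivity)
        _ = _ := by ring
    rw [intervalIntegral.integral_const_mul] at h1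
    have h4 := hM n hn
    have h5 : (n : ℝ) ^ (-((((r + 1 : ℕ) : ℝ) + 1) / 2)) = N := by
      rw [hN]; congr 1; push_cast; ring
    rw [h5] at h4
    calc _ ≤ _ := h1
      _ ≤ (K * (1 + |y|) ^ (r + 1) * Real.exp (c * π ^ 2)) * (M * N) := by
          gcongr
          · exact intervalIntegral.integral_nonneg (by linarith [Real.pi_pos])
              fun t _ => by positivity
          · linarith
      _ = _ := by ring
  have hsplit : ((2 * π)⁻¹ : ℂ) * J φ n (fun t => Complex.exp ((-(t * y) : ℝ) * Complex.I)) =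
      ((2 * π)⁻¹ : ℂ) * J φ n ρ + ∑ l ∈ Finset.range (r + 1), e l * (y : ℂ) ^ l *
        J φ n (fun t => (t : ℂ) ^ l) := by
    have h1 : J φ n (fun t => Complex.exp ((-(t * y) : ℝ) * Complex.I)) = J φ n ρ +
        J φ n (fun t => ∑ l ∈ Finset.range (r + 1),
          ((-(t * y) : ℝ) * Complex.I) ^ l / (l.factorial : ℂ)) := by
      rw [← J_add hφ hρc (by fun_prop)]
      congr 1; ext t; simp only [hρ]; ring
    have h2 : J φ n (fun t => ∑ l ∈ Finset.range (r + 1),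
          ((-(t * y) : ℝ) * Complex.I) ^ l / (l.factorial : ℂ)) =
        ∑ l ∈ Finset.range (r + 1), ((-Complex.I) ^ l / (l.factorial : ℂ)) * (y : ℂ) ^ l *
          J φ n (fun t => (t : ℂ) ^ l) := by
      simp_rw [← J_const_mul]
      simp only [J]
      rw [← intervalIntegral.integral_finsetSum]
      · congr 1; ext t
        rw [Finset.mul_sum]
        refine Finset.sum_congr rfl fun l _ => ?_
        rw [show ((-(t * y) : ℝ) : ℂ) * Complex.I = (-Complex.I) * y * t by push_cast; ring]
        ring
      · intro l _
        exact Continuous.intervalIntegrable (by fun_prop) _ _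
    rw [h1, h2, mul_add, Finset.mul_sum]
    congr 1
    refine Finset.sum_congr rfl fun l _ => ?_
    simp only [he]; ring
  have hθsum : ∑ k ∈ Finset.range (r / 2 + 1), (θ k).eval y * a (k + 1) (n - 1) =
      (∑ l ∈ Finset.range (r + 1), e l * (y : ℂ) ^ l *
        ∑ k ∈ Finset.range (r / 2 + 1), d l k * (a (k + 1) (n - 1) : ℝ)).re := by
    simp_rw [Complex.re_sum, Finset.mul_sum, hθ, eval_finsetSum, Finset.sum_mul, eval_monomial]
    rw [Finset.sum_comm]
    refine Finset.sum_congr rfl fun l _ => ?_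
    rw [Complex.re_sum]
    refine Finset.sum_congr rfl fun k _ => ?_
    rw [show e l * (y : ℂ) ^ l * (d l k * (a (k + 1) (n - 1) : ℝ)) =
      e l * d l k * ((y ^ l * a (k + 1) (n - 1) : ℝ) : ℂ) by push_cast; ring,
      Complex.re_mul_ofReal]
    ring
  rw [hθsum, hsplit, ← Complex.sub_re]
  refine (Complex.abs_re_le_norm _).trans ?_
  rw [add_sub_assoc, ← Finset.sum_sub_distrib]
  refine (norm_add_le _ _).trans ?_
  rw [norm_mul, add_mul, add_mul]
  refine add_le_add ?_ ?_
  · calc _ ≤ ‖((2 * π)⁻¹ : ℂ)‖ * (K * (Real.exp (c * π ^ 2) * M) * (1 + |y|) ^ (r + 1) * N) := by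
          gcongr
      _ = _ := by ring
  · rw [Finset.sum_mul, Finset.sum_mul]
    refine norm_sum_le_of_le _ fun l hl => ?_
    have hl' : l ≤ r := Nat.lt_succ_iff.1 (Finset.mem_range.1 hl)
    rw [← mul_sub, norm_mul, norm_mul, norm_pow, Complex.norm_real, Real.norm_eq_abs]
    have h1 : |y| ^ l ≤ (1 + |y|) ^ (r + 1) :=
      (pow_le_pow_left₀ (abs_nonneg y) (by linarith) l).trans
        (pow_le_pow_right₀ hy1 (by omega))
    calc _ ≤ ‖e l‖ * (1 + |y|) ^ (r + 1) * (|B l| * N) := by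
          gcongr
          exact (hB l hl' n hn).trans (mul_le_mul_of_nonneg_right (le_abs_self _) hN0)
      _ = _ := by ring

end IsGaussianLike

/-! ### The characteristic function of an increment -/

/-- The law of an increment of the walk: a probability measure on `{-1, 0, 1, …}` with a finite
moment of order `r + 3`, mean zero, positive variance and maximal span `1`. -/
structure IsStepLaw (r : ℕ) (μ : Measure ℝ) : Prop where
  isProbabilityMeasure : IsProbabilityMeasure μ
  integrable : Integrable (fun x : ℝ => |x| ^ (r + 3)) μ
  mean : ∫ x, x ∂μ = 0
  variance_pos : 0 < ∫ x, x ^ 2 ∂μ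
  left : ∀ᵐ x : ℝ ∂μ, ∃ k : ℤ, -1 ≤ k ∧ x = k
  span : ∀ d : ℝ, 1 < d → ¬ ∃ b : ℝ, ∀ᵐ x : ℝ ∂μ, ∃ k : ℤ, x = b + k * d

/-- The derivative of the characteristic function, written as an integral. -/
noncomputable def charFunDeriv (μ : Measure ℝ) (t : ℝ) : ℂ :=
  Complex.I * ∫ x, x * Complex.exp (t * x * Complex.I) ∂μ

/-- The Taylor polynomial of degree `m - 1` of the characteristic function at `0`. -/
noncomputable def charFunTaylor (μ : Measure ℝ) (m : ℕ) : ℂ[X] :=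
  ∑ j ∈ Finset.range m, monomial j (Complex.I ^ j / (j.factorial : ℂ) * (∫ x, x ^ j ∂μ : ℝ))

namespace IsStepLaw

variable {r : ℕ} {μ : Measure ℝ} (h : IsStepLaw r μ)

include h

lemma memLp {m : ℕ} (hm : m ≤ r + 3) : MemLp id (m : ENNReal) μ := by
  have := h.isProbabilityMeasure
  have h1 : MemLp id ((r + 3 : ℕ) : ENNReal) μ := by
    rw [← integrable_norm_rpow_iff aestronglyMeasurable_id (by simp) (by simp)]
    refine h.integrable.congr (ae_of_all _ fun x => ?_)
    simp only [ENNReal.toReal_natCast, Real.rpow_natCast, id, Real.norm_eq_abs]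
  exact h1.mono_exponent (by exact_mod_cast hm)

lemma integrable_pow {m : ℕ} (hm : m ≤ r + 3) : Integrable (fun x : ℝ => x ^ m) μ := by
  have := h.isProbabilityMeasure
  refine ((h.memLp hm).integrable_norm_pow').mono' (by fun_prop) (ae_of_all _ fun x => ?_)
  simp

lemma hasDerivAt_charFun (t : ℝ) : HasDerivAt (charFun μ) (charFunDeriv μ t) t := by
  have := h.isProbabilityMeasure
  have h1 : MemLp id ((1 : ℕ) : ENNReal) μ := h.memLp (by omega)
  have h2 := ((contDiff_charFun h1).differentiable (by simp)) t
  have h3 := iteratedDeriv_charFun (t := t) h1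
  rw [iteratedDeriv_one] at h3
  have h4 : charFunDeriv μ t = deriv (charFun μ) t := by rw [h3]; simp [charFunDeriv]
  rw [h4]
  exact h2.hasDerivAt

lemma continuous_charFunDeriv : Continuous (charFunDeriv μ) := by
  have := h.isProbabilityMeasure
  have h1 : MemLp id ((1 : ℕ) : ENNReal) μ := h.memLp (by omega)
  have h2 := (contDiff_charFun h1).continuous_deriv (by simp)
  have h3 : charFunDeriv μ = deriv (charFun μ) := by
    ext t; rw [(h.hasDerivAt_charFun t).deriv]
  rwa [h3]

omit h in
lemma integrable_exp [IsProbabilityMeasure μ] (t : ℝ) :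
    Integrable (fun x : ℝ => Complex.exp (t * x * Complex.I)) μ := by
  refine (integrable_const (1 : ℝ)).mono' (by fun_prop) (ae_of_all _ fun x => ?_)
  rw [← Complex.ofReal_mul, Complex.norm_exp_ofReal_mul_I]

lemma integrable_ofReal_pow {m : ℕ} (hm : m ≤ r + 3) :
    Integrable (fun x : ℝ => (x : ℂ) ^ m) μ := by
  have := (h.integrable_pow hm).ofReal (𝕜 := ℂ)
  simpa using this

lemma norm_charFun_sub_taylor : (fun t : ℝ => charFun μ t -
    (charFunTaylor μ (r + 3)).eval (t : ℂ)) =O[period] fun t => t ^ (r + 3) := by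
  have := h.isProbabilityMeasure
  obtain ⟨K, hK0, hK⟩ := exists_norm_exp_sub_taylor_le (r + 3)
  refine isBigO_principal.2 ⟨K * ∫ x, |x| ^ (r + 3) ∂μ, fun t _ => ?_⟩
  have hsum : charFun μ t - (charFunTaylor μ (r + 3)).eval (t : ℂ) =
      ∫ x, (Complex.exp (t * x * Complex.I) - ∑ j ∈ Finset.range (r + 3),
        (t * x * Complex.I) ^ j / (j.factorial : ℂ)) ∂μ := by
    rw [integral_sub (integrable_exp t)]
    · rw [charFun_apply_real, charFunTaylor, eval_finsetSum, integral_finsetSum]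
      · congr 1
        refine Finset.sum_congr rfl fun j _ => ?_
        rw [eval_monomial, ← integral_complex_ofReal]
        simp_rw [mul_pow, div_eq_mul_inv]
        rw [integral_mul_const, integral_mul_const, integral_const_mul]
        push_cast
        ring
      · intro j hj
        simp_rw [mul_pow]
        exact (((h.integrable_ofReal_pow (Finset.mem_range.1 hj).le).const_mul _).mul_const
          _).div_const _
    · refine integrable_finsetSum _ fun j hj => ?_
      simp_rw [mul_pow]
      exact (((h.integrable_ofReal_pow (Finset.mem_range.1 hj).le).const_mul _).mul_const
          _).div_const _
  rw [hsum, norm_pow, Real.norm_eq_abs]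
  calc _ ≤ ∫ x, K * |t| ^ (r + 3) * |x| ^ (r + 3) ∂μ := by
        refine norm_integral_le_of_norm_le (h.integrable.const_mul _) (ae_of_all _ fun x => ?_)
        have := hK (t * x)
        rw [abs_mul, mul_pow] at this
        push_cast at this
        linarith
    _ = _ := by rw [integral_const_mul]; ring

lemma norm_charFunDeriv_sub_taylor : (fun t : ℝ => charFunDeriv μ t -
    (derivative (charFunTaylor μ (r + 3))).eval (t : ℂ)) =O[period] fun t => t ^ (r + 2) := by
  have := h.isProbabilityMeasure
  obtain ⟨K, hK0, hK⟩ := exists_norm_exp_sub_taylor_le (r + 2)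
  refine isBigO_principal.2 ⟨K * ∫ x, |x| ^ (r + 3) ∂μ, fun t _ => ?_⟩
  have hint : ∀ j ∈ Finset.range (r + 2), Integrable (fun x : ℝ =>
      Complex.I * x * ((t * x * Complex.I) ^ j / (j.factorial : ℂ))) μ := by
    intro j hj
    have h1 := (h.integrable_ofReal_pow (m := j + 1)
      (by have := Finset.mem_range.1 hj; omega)).const_mul
      (Complex.I ^ (j + 1) * (t : ℂ) ^ j / (j.factorial : ℂ))
    refine h1.congr (ae_of_all _ fun x => ?_)
    simp only [mul_pow, pow_succ]
    ring
  have hint0 : Integrable (fun x : ℝ => Complex.I * x * Complex.exp (t * x * Complex.I)) μ := by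
    have h1 := (h.integrable_pow (m := 1) (by omega)).norm
    refine h1.mono' (by fun_prop) (ae_of_all _ fun x => ?_)
    rw [norm_mul, ← Complex.ofReal_mul, Complex.norm_exp_ofReal_mul_I]
    simp
  have hsum : charFunDeriv μ t - (derivative (charFunTaylor μ (r + 3))).eval (t : ℂ) =
      ∫ x, Complex.I * x * (Complex.exp (t * x * Complex.I) - ∑ j ∈ Finset.range (r + 2),
        (t * x * Complex.I) ^ j / (j.factorial : ℂ)) ∂μ := by
    simp_rw [mul_sub, Finset.mul_sum]
    rw [integral_sub hint0 (integrable_finsetSum _ hint), integral_finsetSum _ hint,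
      charFunDeriv, ← integral_const_mul, charFunTaylor, derivative_sum, eval_finsetSum,
      Finset.sum_range_succ']
    congr 1
    · simp_rw [mul_assoc]
    · simp only [derivative_monomial, eval_monomial]
      simp only [Nat.cast_zero, mul_zero, zero_mul, add_zero, Nat.add_sub_cancel]
      refine Finset.sum_congr rfl fun j _ => ?_
      have e1 : ∀ x : ℝ, Complex.I * x * ((t * x * Complex.I) ^ j / (j.factorial : ℂ)) =
          (Complex.I ^ (j + 1) * (t : ℂ) ^ j / (j.factorial : ℂ)) * ((x ^ (j + 1) : ℝ) : ℂ) := by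
        intro x
        push_cast
        simp only [mul_pow, pow_succ]
        ring
      simp_rw [e1]
      rw [integral_const_mul, integral_complex_ofReal, Nat.factorial_succ]
      have e2 : (j.factorial : ℂ) ≠ 0 := by exact_mod_cast j.factorial_ne_zero
      have e3 : ((j : ℂ) + 1) ≠ 0 := by exact_mod_cast Nat.succ_ne_zero j
      push_cast
      field_simp
  rw [hsum, norm_pow, Real.norm_eq_abs]
  calc _ ≤ ∫ x, K * |t| ^ (r + 2) * |x| ^ (r + 3) ∂μ := by
        refine norm_integral_le_of_norm_le (h.integrable.const_mul _) (ae_of_all _ fun x => ?_)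
        have := hK (t * x)
        rw [abs_mul, mul_pow] at this
        push_cast at this
        rw [norm_mul, norm_mul, Complex.norm_I, one_mul, Complex.norm_real, Real.norm_eq_abs]
        calc _ ≤ |x| * (K * (|t| ^ (r + 2) * |x| ^ (r + 2))) := by gcongr
          _ = _ := by ring
    _ = _ := by rw [integral_const_mul]; ring

lemma exists_charFunTaylor_eq : ∃ u : ℂ[X], charFunTaylor μ (r + 3) =
    1 - X ^ 2 * (C (((∫ x, x ^ 2 ∂μ) / 2 : ℝ) : ℂ) + X * u) := by
  have := h.isProbabilityMeasure
  set f : ℕ → ℂ := fun j => Complex.I ^ j / (j.factorial : ℂ) * (∫ x, x ^ j ∂μ : ℝ) with hf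
  have h0 : f 0 = 1 := by simp [hf]
  have h1 : f 1 = 0 := by simp [hf, h.mean]
  have h2 : f 2 = -(((∫ x, x ^ 2 ∂μ) / 2 : ℝ) : ℂ) := by
    simp only [hf, Complex.I_sq, Nat.factorial_two]
    push_cast; ring
  refine ⟨-∑ j ∈ Finset.range r, C (f (j + 3)) * X ^ j, ?_⟩
  have hT : charFunTaylor μ (r + 3) = ∑ j ∈ Finset.range (r + 3), C (f j) * X ^ j :=
    Finset.sum_congr rfl fun j _ => (C_mul_X_pow_eq_monomial).symm
  rw [hT, Finset.sum_range_succ', Finset.sum_range_succ', Finset.sum_range_succ']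
  simp only [zero_add, Nat.add_assoc, Nat.reduceAdd]
  have e2 : ∑ j ∈ Finset.range r, C (f (j + 3)) * X ^ (j + 3) =
      X ^ 3 * ∑ j ∈ Finset.range r, C (f (j + 3)) * X ^ j := by
    rw [Finset.mul_sum]
    exact Finset.sum_congr rfl fun j _ => by ring
  rw [e2, h0, h1, h2, C_neg, C_0, C_1]
  ring

lemma norm_charFun_lt_one {t : ℝ} (ht0 : t ≠ 0) (ht : |t| ≤ π) : ‖charFun μ t‖ < 1 := by
  have := h.isProbabilityMeasure
  refine lt_of_le_of_ne (norm_charFun_le_one t) fun hnorm => ?_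
  set z := charFun μ t with hz
  have hzz : (starRingEnd ℂ) z * z = 1 := by
    rw [mul_comm, Complex.mul_conj, Complex.normSq_eq_norm_sq, hnorm]; simp
  have hexp := integrable_exp (μ := μ) t
  -- `1 - Re (conj z exp(itx))` is nonnegative and has integral zero
  have hre : Integrable (fun x : ℝ =>
      ((starRingEnd ℂ) z * Complex.exp (t * x * Complex.I)).re) μ := (hexp.const_mul _).re
  have hint : Integrable (fun x : ℝ =>
      1 - ((starRingEnd ℂ) z * Complex.exp (t * x * Complex.I)).re) μ :=
    (integrable_const _).sub hre
  have hzero : ∫ x, (1 - ((starRingEnd ℂ) z * Complex.exp (t * x * Complex.I)).re) ∂μ = 0 := by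
    have e1 : ∫ x, ((starRingEnd ℂ) z * Complex.exp (t * x * Complex.I)).re ∂μ = 1 := by
      have e2 := integral_re (𝕜 := ℂ) (hexp.const_mul ((starRingEnd ℂ) z))
      simp only [RCLike.re_eq_complex_re] at e2
      rw [e2, integral_const_mul, ← charFun_apply_real, ← hz, hzz, Complex.one_re]
    rw [integral_sub (integrable_const _) hre, e1]
    simp
  have hre_le : ∀ x : ℝ, ((starRingEnd ℂ) z * Complex.exp (t * x * Complex.I)).re ≤ 1 := by
    intro x
    refine (Complex.re_le_norm _).trans ?_
    rw [norm_mul, ← Complex.ofReal_mul, Complex.norm_exp_ofReal_mul_I, RCLike.norm_conj, hnorm,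
      one_mul]
  have hae := (integral_eq_zero_iff_of_nonneg (fun x => sub_nonneg.2 (hre_le x)) hint).1 hzero
  -- so `exp(itx)` is almost surely constant and `μ` lives on a progression of step `2π / |t| ≥ 2`
  have hd : 1 < 2 * π / |t| := by
    rw [lt_div_iff₀ (abs_pos.2 ht0)]
    linarith [Real.pi_pos]
  refine h.span _ hd ⟨Complex.arg z / t, ?_⟩
  filter_upwards [hae] with x hx
  have hx : ((starRingEnd ℂ) z * Complex.exp (t * x * Complex.I)).re = 1 := by
    have : 1 - ((starRingEnd ℂ) z * Complex.exp (t * x * Complex.I)).re = 0 := hx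
    linarith
  have hw : (starRingEnd ℂ) z * Complex.exp (t * x * Complex.I) = 1 := by
    set w := (starRingEnd ℂ) z * Complex.exp (t * x * Complex.I) with hw
    have hn : ‖w‖ = 1 := by
      rw [hw, norm_mul, ← Complex.ofReal_mul, Complex.norm_exp_ofReal_mul_I, RCLike.norm_conj,
        hnorm, one_mul]
    have hsq := Complex.sq_norm w
    rw [Complex.normSq_apply, hn, hx] at hsq
    refine Complex.ext (by simpa using hx) ?_
    have : w.im * w.im = 0 := by linarith
    simpa using this
  have hexpz : Complex.exp (t * x * Complex.I) = Complex.exp (Complex.arg z * Complex.I) := by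
    have e1 : Complex.exp (Complex.arg z * Complex.I) = z := by
      have := Complex.norm_mul_exp_arg_mul_I z
      rwa [hnorm, Complex.ofReal_one, one_mul] at this
    rw [e1]
    calc _ = (z * (starRingEnd ℂ) z) * Complex.exp (t * x * Complex.I) := by
          rw [mul_comm z, hzz, one_mul]
      _ = z := by rw [mul_assoc, hw, mul_one]
  obtain ⟨k, hk⟩ := Complex.exp_eq_exp_iff_exists_int.1 hexpz
  have hk' : t * x = Complex.arg z + k * (2 * π) := by
    have e1 : ((t * x : ℝ) : ℂ) * Complex.I =
        ((Complex.arg z + k * (2 * π) : ℝ) : ℂ) * Complex.I := by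
      push_cast; rw [hk]; ring
    exact_mod_cast mul_right_cancel₀ Complex.I_ne_zero e1
  have hx' : x = Complex.arg z / t + k * (2 * π / t) := by
    field_simp
    linarith
  rcases lt_or_gt_of_ne ht0 with hneg | hpos
  · refine ⟨-k, ?_⟩
    rw [abs_of_neg hneg, hx']
    push_cast
    field_simp
  · exact ⟨k, by rw [abs_of_pos hpos]; exact hx'⟩

lemma exists_norm_charFun_le : ∃ c : ℝ, 0 < c ∧ c ≤ (∫ x, x ^ 2 ∂μ) / 2 ∧
    ∀ t ∈ Set.Icc (-π) π, ‖charFun μ t‖ ≤ Real.exp (-c * t ^ 2) := by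
  have := h.isProbabilityMeasure
  set v := (∫ x, x ^ 2 ∂μ) / 2 with hv
  have hv0 : 0 < v := by have := h.variance_pos; positivity
  obtain ⟨u, hu⟩ := h.exists_charFunTaylor_eq
  have hO : (fun t : ℝ => charFun μ t - (1 - v * t ^ 2 : ℝ)) =O[period] fun t => t ^ 3 := by
    have e1 := h.norm_charFun_sub_taylor.trans (isBigO_pow_of_le (show 3 ≤ r + 3 by omega))
    have e2 := isBigO_eval_of_dvd (g := X ^ 3 * (-u)) (m := 3) ⟨_, rfl⟩
    refine (e1.add e2).congr_left fun t => ?_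
    rw [hu, ← hv]
    simp only [eval_sub, eval_one, eval_mul, eval_pow, eval_X, eval_add, eval_C, eval_neg]
    push_cast
    ring
  obtain ⟨K, hK⟩ := isBigO_principal.1 hO
  set δ : ℝ := min 1 (min (1 / v) (v / (2 * (|K| + 1)))) with hδ
  have hδ0 : 0 < δ := by positivity
  have hδ1 : δ ≤ 1 := min_le_left _ _
  have hδv : v * δ ≤ 1 := by
    have : δ ≤ 1 / v := (min_le_right _ _).trans (min_le_left _ _)
    rwa [le_div_iff₀ hv0, mul_comm] at this
  have hδK : |K| * δ ≤ v / 2 := by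
    have h1 : δ ≤ v / (2 * (|K| + 1)) := (min_le_right _ _).trans (min_le_right _ _)
    rw [le_div_iff₀ (by positivity)] at h1
    nlinarith [abs_nonneg K]
  have hnear : ∀ t : ℝ, |t| ≤ δ → ‖charFun μ t‖ ≤ Real.exp (-(v / 2) * t ^ 2) := by
    intro t ht
    have htp : t ∈ Set.Icc (-π) π := abs_le.1 (by linarith [Real.pi_gt_three])
    have h1 := hK t htp
    have h2 : t ^ 2 = |t| ^ 2 := (sq_abs t).symm
    have h3 : 0 ≤ 1 - v * t ^ 2 := by
      have : |t| ^ 2 ≤ δ := by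
        calc |t| ^ 2 ≤ δ ^ 2 := pow_le_pow_left₀ (abs_nonneg t) ht 2
          _ ≤ δ := by nlinarith
      have := mul_le_mul_of_nonneg_left this hv0.le
      rw [h2]; linarith
    have h4 : ‖charFun μ t‖ ≤ (1 - v * t ^ 2) + K * ‖t ^ 3‖ := by
      have h5 := norm_le_norm_add_norm_sub' (charFun μ t) ((1 - v * t ^ 2 : ℝ) : ℂ)
      rw [Complex.norm_real, Real.norm_of_nonneg h3] at h5
      linarith
    have h6 : K * ‖t ^ 3‖ ≤ v / 2 * t ^ 2 := by
      rw [norm_pow, Real.norm_eq_abs, h2]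
      calc K * |t| ^ 3 ≤ |K| * |t| ^ 3 := by gcongr; exact le_abs_self K
        _ = |K| * |t| * |t| ^ 2 := by ring
        _ ≤ |K| * δ * |t| ^ 2 := by gcongr
        _ ≤ v / 2 * |t| ^ 2 := by gcongr
    have h7 := Real.add_one_le_exp (-(v / 2) * t ^ 2)
    linarith
  have hcomp : IsCompact (Set.Icc (-π) π ∩ {t : ℝ | δ ≤ |t|}) :=
    isCompact_Icc.inter_right (isClosed_le continuous_const continuous_abs)
  obtain ⟨t₀, ht₀, hmax⟩ := hcomp.exists_isMaxOn
    ⟨π, ⟨by linarith [Real.pi_pos], le_rfl⟩, by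
      rw [Set.mem_ofPred_eq, abs_of_pos Real.pi_pos]; linarith [Real.pi_gt_three]⟩
    (continuous_charFun (μ := μ)).norm.continuousOn
  have hlt : ‖charFun μ t₀‖ < 1 := h.norm_charFun_lt_one
    (abs_pos.1 (hδ0.trans_le ht₀.2)) (abs_le.2 ht₀.1)
  set ρ := max ‖charFun μ t₀‖ (1 / 2) with hρ
  have hρ0 : 0 < ρ := lt_max_of_lt_right (by norm_num)
  have hρ1 : ρ < 1 := max_lt hlt (by norm_num)
  have hlog : 0 < -Real.log ρ := neg_pos.2 (Real.log_neg hρ0 hρ1)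
  refine ⟨min (v / 2) (-Real.log ρ / π ^ 2), by positivity, (min_le_left _ _).trans (by linarith),
    fun t ht => ?_⟩
  rcases le_or_gt |t| δ with hle | hgt
  · refine (hnear t hle).trans (Real.exp_le_exp.2 ?_)
    have := mul_le_mul_of_nonneg_right (min_le_left (v / 2) (-Real.log ρ / π ^ 2)) (sq_nonneg t)
    linarith
  · have h1 : ‖charFun μ t‖ ≤ ρ := (hmax ⟨ht, hgt.le⟩).trans (le_max_left _ _)
    refine h1.trans ?_
    rw [← Real.log_le_iff_le_exp hρ0]
    have h2 := mul_le_mul_of_nonneg_right (min_le_right (v / 2) (-Real.log ρ / π ^ 2))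
      (sq_nonneg t)
    have h3 : t ^ 2 ≤ π ^ 2 := sq_le_sq' ht.1 ht.2
    have h4 : -Real.log ρ / π ^ 2 * t ^ 2 ≤ -Real.log ρ := by
      rw [div_mul_eq_mul_div, div_le_iff₀ (by positivity)]
      exact mul_le_mul_of_nonneg_left h3 hlog.le
    linarith

lemma exists_isGaussianLike : ∃ c : ℝ, IsGaussianLike r (charFun μ) (charFunDeriv μ)
    (charFunTaylor μ (r + 3)) ((∫ x, x ^ 2 ∂μ) / 2) c := by
  obtain ⟨c, hc, hcv, hle⟩ := h.exists_norm_charFun_le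
  exact ⟨c, h.hasDerivAt_charFun, h.continuous_charFunDeriv, hc, hcv, hle,
    h.exists_charFunTaylor_eq, h.norm_charFun_sub_taylor, h.norm_charFunDeriv_sub_taylor⟩

end IsStepLaw

/-! ### Fourier inversion -/

lemma integral_exp_int (m : ℤ) : ∫ t in (-π)..π, Complex.exp (t * (m : ℝ) * Complex.I) =
    if m = 0 then (2 * π : ℂ) else 0 := by
  split_ifs with hm
  · subst hm
    simp
    ring
  · have hc : (m : ℂ) * Complex.I ≠ 0 :=
      mul_ne_zero (by exact_mod_cast hm) Complex.I_ne_zero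
    have e : ∀ t : ℝ, (t : ℂ) * ((m : ℝ) : ℂ) * Complex.I = (m : ℂ) * Complex.I * t := by
      intro t; push_cast; ring
    simp_rw [e]
    rw [integral_exp_mul_complex hc, div_eq_zero_iff]
    left
    rw [sub_eq_zero, Complex.exp_eq_exp_iff_exists_int]
    exact ⟨m, by push_cast; ring⟩

lemma integral_mul_intervalIntegral_swap {μ : Measure ℝ} [IsProbabilityMeasure μ] {w G : ℝ → ℂ}
    (hw : Integrable w μ) (hG : Continuous G) :
    ∫ x, w x * (∫ t in (-π)..π, G t * Complex.exp (t * x * Complex.I)) ∂μ =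
      ∫ t in (-π)..π, G t * ∫ x, w x * Complex.exp (t * x * Complex.I) ∂μ := by
  have hint : Integrable (Function.uncurry fun (t x : ℝ) =>
      G t * (w x * Complex.exp (t * x * Complex.I)))
      ((volume.restrict (Set.uIoc (-π) π)).prod μ) := by
    have h1 : Integrable G (volume.restrict (Set.uIoc (-π) π)) :=
      intervalIntegrable_iff.1 (hG.intervalIntegrable (-π) π)
    have h2 := h1.mul_prod hw
    have h3 : AEStronglyMeasurable (fun p : ℝ × ℝ => Complex.exp (p.1 * p.2 * Complex.I))
        ((volume.restrict (Set.uIoc (-π) π)).prod μ) := by fun_prop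
    refine (h2.mono (h2.aestronglyMeasurable.mul h3) (ae_of_all _ fun p => ?_)).congr
      (ae_of_all _ fun p => ?_)
    · simp only [Pi.mul_apply]
      rw [norm_mul, ← Complex.ofReal_mul, Complex.norm_exp_ofReal_mul_I, mul_one]
    · simp only [Pi.mul_apply, Function.uncurry]
      ring
  have h := intervalIntegral_integral_swap hint
  simp_rw [integral_const_mul] at h
  rw [h]
  congr 1; ext x
  rw [← intervalIntegral.integral_const_mul]
  congr 1; ext t; ring

/-- The `n`-step transition probability of the walk, as a Fourier coefficient of the `n`-th power
of the characteristic function of the increments. It is a function on the whole line, and is the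
probability `P (S_n = y)` at the integers. -/
noncomputable def latticeProb (μ : Measure ℝ) (n : ℕ) (y : ℝ) : ℝ :=
  (((2 * π)⁻¹ : ℂ) * J (charFun μ) n (fun t => Complex.exp ((-(t * y) : ℝ) * Complex.I))).re

lemma measureReal_singleton_eq {ν : Measure ℝ} [IsProbabilityMeasure ν]
    (hν : ∀ᵐ x : ℝ ∂ν, ∃ k : ℤ, x = k) (y : ℤ) :
    ((ν.real {(y : ℝ)} : ℝ) : ℂ) = ((2 * π)⁻¹ : ℂ) *
      ∫ t in (-π)..π, charFun ν t * Complex.exp ((-(t * y) : ℝ) * Complex.I) := by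
  have h := integral_mul_intervalIntegral_swap (μ := ν) (w := fun _ => 1)
    (G := fun t => Complex.exp ((-(t * y) : ℝ) * Complex.I)) (integrable_const _) (by fun_prop)
  simp only [one_mul, ← charFun_apply_real] at h
  have h1 : ∫ x, (∫ t in (-π)..π, Complex.exp ((-(t * y) : ℝ) * Complex.I) *
      Complex.exp (t * x * Complex.I)) ∂ν = 2 * π * ν.real {(y : ℝ)} := by
    have h2 : ∀ᵐ x : ℝ ∂ν, (∫ t in (-π)..π, Complex.exp ((-(t * y) : ℝ) * Complex.I) *
        Complex.exp (t * x * Complex.I)) =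
        Set.indicator {(y : ℝ)} (fun _ => (2 * π : ℂ)) x := by
      filter_upwards [hν] with x hx
      obtain ⟨k, rfl⟩ := hx
      have e : ∀ t : ℝ, Complex.exp ((-(t * y) : ℝ) * Complex.I) *
          Complex.exp (t * (k : ℝ) * Complex.I) =
          Complex.exp (t * (((k - y : ℤ) : ℝ) : ℂ) * Complex.I) := by
        intro t
        rw [← Complex.exp_add]; congr 1; push_cast; ring
      simp_rw [e]
      rw [integral_exp_int, Set.indicator_apply]
      simp [sub_eq_zero]
    rw [integral_congr_ae h2, integral_indicator_const _ (measurableSet_singleton _),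
      Complex.real_smul]
    ring
  rw [h1] at h
  have hπ : (2 * π : ℂ) ≠ 0 := by
    exact_mod_cast (by positivity : (2 * π : ℝ) ≠ 0)
  simp_rw [mul_comm (charFun ν _)]
  rw [← h, inv_mul_cancel_left₀ hπ]

lemma continuous_J_exp {φ : ℝ → ℂ} (hφ : Continuous φ) (n : ℕ) :
    Continuous fun y : ℝ => J φ n (fun t => Complex.exp ((-(t * y) : ℝ) * Complex.I)) := by
  unfold J
  exact intervalIntegral.continuous_parametric_intervalIntegral_of_continuous' (by fun_prop) _ _

lemma norm_J_exp_le {φ : ℝ → ℂ} (hφ : ∀ t, ‖φ t‖ ≤ 1) (n : ℕ) (y : ℝ) :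
    ‖J φ n (fun t => Complex.exp ((-(t * y) : ℝ) * Complex.I))‖ ≤ 2 * π := by
  have h := intervalIntegral.norm_integral_le_of_norm_le_const (a := -π) (b := π) (C := 1)
    (f := fun t => φ t ^ n * Complex.exp ((-(t * y) : ℝ) * Complex.I)) fun t _ => by
      rw [norm_mul, Complex.norm_exp_ofReal_mul_I, mul_one, norm_pow]
      exact pow_le_one₀ (norm_nonneg _) (hφ t)
  rw [one_mul, sub_neg_eq_add, abs_of_pos (by positivity)] at h
  unfold J
  linarith

lemma J_exp_sub (φ : ℝ → ℂ) (n : ℕ) (y x : ℝ) :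
    J φ n (fun t => Complex.exp ((-(t * (y - x)) : ℝ) * Complex.I)) =
      ∫ t in (-π)..π, (φ t ^ n * Complex.exp ((-(t * y) : ℝ) * Complex.I)) *
        Complex.exp (t * x * Complex.I) := by
  unfold J
  congr 1; ext t
  rw [mul_assoc, ← Complex.exp_add]
  refine congrArg (fun z => φ t ^ n * Complex.exp z) ?_
  push_cast; ring

namespace IsStepLaw

variable {r : ℕ} {μ : Measure ℝ} (h : IsStepLaw r μ)

include h

lemma integrable_mul_J {w : ℝ → ℂ} (hw : Integrable w μ) (n : ℕ) (y : ℝ) :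
    Integrable (fun x : ℝ => w x *
      (((2 * π)⁻¹ : ℂ) * J (charFun μ) n
        (fun t => Complex.exp ((-(t * (y - x)) : ℝ) * Complex.I)))) μ := by
  have := h.isProbabilityMeasure
  have hc : Continuous fun x : ℝ => ((2 * π)⁻¹ : ℂ) * J (charFun μ) n
        (fun t => Complex.exp ((-(t * (y - x)) : ℝ) * Complex.I)) :=
    continuous_const.mul ((continuous_J_exp continuous_charFun n).comp (by fun_prop))
  refine hw.mul_bdd (c := ‖((2 * π)⁻¹ : ℂ)‖ * (2 * π)) hc.aestronglyMeasurable
    (ae_of_all _ fun x => ?_)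
  rw [norm_mul]
  gcongr
  exact norm_J_exp_le norm_charFun_le_one n _

lemma integral_mul_latticeProb {w : ℝ → ℝ} (hw : Integrable w μ) (n : ℕ) (y : ℝ) :
    Integrable (fun x => w x * latticeProb μ n (y - x)) μ ∧
    ∫ x, w x * latticeProb μ n (y - x) ∂μ = (((2 * π)⁻¹ : ℂ) * J (charFun μ) n
      (fun t => Complex.exp ((-(t * y) : ℝ) * Complex.I) *
        ∫ x, (w x : ℂ) * Complex.exp (t * x * Complex.I) ∂μ)).re := by
  have := h.isProbabilityMeasure
  have hwc : Integrable (fun x => (w x : ℂ)) μ := hw.ofReal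
  have h1 := h.integrable_mul_J hwc n y
  have hre : ∀ x : ℝ, w x * latticeProb μ n (y - x) = ((w x : ℂ) * (((2 * π)⁻¹ : ℂ) *
      J (charFun μ) n (fun t => Complex.exp ((-(t * (y - x)) : ℝ) * Complex.I)))).re := by
    intro x
    rw [Complex.re_ofReal_mul, latticeProb]
  simp_rw [hre]
  refine ⟨h1.re, ?_⟩
  have h2 := integral_re (𝕜 := ℂ) h1
  simp only [RCLike.re_eq_complex_re] at h2
  rw [h2]
  congr 1
  have hcont : Continuous fun t : ℝ => charFun μ t ^ n *
      Complex.exp ((-(t * y) : ℝ) * Complex.I) := by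
    have := continuous_charFun (μ := μ)
    fun_prop
  simp_rw [mul_left_comm _ ((2 * π)⁻¹ : ℂ)]
  rw [integral_const_mul]
  congr 1
  simp_rw [J_exp_sub]
  rw [integral_mul_intervalIntegral_swap hwc hcont]
  unfold J
  simp_rw [mul_assoc]

lemma integral_latticeProb (n : ℕ) (y : ℝ) :
    Integrable (fun x => latticeProb μ n (y - x)) μ ∧
    ∫ x, latticeProb μ n (y - x) ∂μ = latticeProb μ (n + 1) y := by
  have := h.isProbabilityMeasure
  have h1 := h.integral_mul_latticeProb (w := fun _ => 1) (integrable_const _) n y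
  simp only [one_mul, Complex.ofReal_one, ← charFun_apply_real] at h1
  refine ⟨h1.1, h1.2.trans ?_⟩
  unfold latticeProb J
  congr 3; ext t; ring

lemma charFun_pi : charFun μ π = charFun μ (-π) := by
  rw [charFun_apply_real, charFun_apply_real]
  refine integral_congr_ae ?_
  filter_upwards [h.left] with x hx
  obtain ⟨k, -, rfl⟩ := hx
  rw [Complex.exp_eq_exp_iff_exists_int]
  exact ⟨k, by push_cast; ring⟩

lemma integral_id_mul_latticeProb (n : ℕ) (y : ℤ) :
    Integrable (fun x => x * latticeProb μ n (y - x)) μ ∧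
    ∫ x, x * latticeProb μ n (y - x) ∂μ = y / (n + 1) * latticeProb μ (n + 1) y := by
  have := h.isProbabilityMeasure
  have hid : Integrable (fun x : ℝ => x) μ := by
    simpa using h.integrable_pow (m := 1) (by omega)
  have h1 := h.integral_mul_latticeProb hid n y
  refine ⟨h1.1, h1.2.trans ?_⟩
  have hφ := continuous_charFun (μ := μ)
  have hφ' := h.continuous_charFunDeriv
  set e : ℝ → ℂ := fun t => Complex.exp ((-(t * y) : ℝ) * Complex.I) with he
  have hec : Continuous e := by simp only [he]; fun_prop
  have hde : ∀ t, HasDerivAt e (e t * (-y * Complex.I)) t := by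
    intro t
    have h2 : HasDerivAt (fun t : ℝ => ((-(t * y) : ℝ) : ℂ) * Complex.I) (-y * Complex.I) t := by
      have h3 : HasDerivAt (fun t : ℝ => -(t * (y : ℝ))) (-(1 * (y : ℝ))) t :=
        ((hasDerivAt_id t).mul_const _).neg
      have h4 := h3.ofReal_comp.mul_const Complex.I
      simpa using h4
    exact h2.cexp
  have hd : ∀ t ∈ Set.uIcc (-π) π, HasDerivAt (fun t => charFun μ t ^ (n + 1) * e t)
      ((n + 1) * (charFun μ t ^ n * (e t * charFunDeriv μ t)) -
        (y * Complex.I) * (charFun μ t ^ (n + 1) * e t)) t := by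
    intro t _
    refine (((h.hasDerivAt_charFun t).pow (n + 1)).mul (hde t)).congr_deriv ?_
    simp only [Pi.pow_apply, Nat.add_sub_cancel]
    push_cast
    ring
  have hparts := intervalIntegral.integral_eq_sub_of_hasDerivAt hd
    (Continuous.intervalIntegrable (by fun_prop) _ _)
  -- at an integer `y` the boundary terms at `π` and `-π` cancel
  have hbd : e π = e (-π) := by
    simp only [he]
    rw [Complex.exp_eq_exp_iff_exists_int]
    exact ⟨-y, by push_cast; ring⟩
  rw [h.charFun_pi, hbd, sub_self, intervalIntegral.integral_sub
    (Continuous.intervalIntegrable (by fun_prop) _ _)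
    (Continuous.intervalIntegrable (by fun_prop) _ _), intervalIntegral.integral_const_mul,
    intervalIntegral.integral_const_mul, sub_eq_zero] at hparts
  have hD : ∀ t : ℝ, ∫ x, (x : ℂ) * Complex.exp (t * x * Complex.I) ∂μ =
      -Complex.I * charFunDeriv μ t := by
    intro t
    rw [charFunDeriv, ← mul_assoc]
    simp
  have hn : (n : ℂ) + 1 ≠ 0 := by exact_mod_cast Nat.succ_ne_zero n
  have hJ : J (charFun μ) n (fun t => e t * ∫ x, (x : ℂ) * Complex.exp (t * x * Complex.I) ∂μ) =
      ((y / (n + 1) : ℝ) : ℂ) * J (charFun μ) (n + 1) e := by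
    have h5 : J (charFun μ) n (fun t => e t * ∫ x, (x : ℂ) * Complex.exp (t * x * Complex.I) ∂μ) =
        -Complex.I * ∫ t in (-π)..π, charFun μ t ^ n * (e t * charFunDeriv μ t) := by
      rw [← intervalIntegral.integral_const_mul]
      unfold J
      congr 1; ext t
      simp only [hD]; ring
    rw [h5]
    have h6 : (∫ t in (-π)..π, charFun μ t ^ n * (e t * charFunDeriv μ t)) =
        (y * Complex.I) * J (charFun μ) (n + 1) e / (n + 1) := by
      rw [eq_div_iff hn, mul_comm]; exact hparts
    rw [h6]
    push_cast
    field_simp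
    rw [Complex.I_sq]
    ring
  rw [hJ, mul_left_comm, Complex.re_ofReal_mul, latticeProb]

lemma tendsto_latticeProb (y : ℝ) : Tendsto (fun n => latticeProb μ n y) atTop (𝓝 0) := by
  obtain ⟨c, hc⟩ := h.exists_isGaussianLike
  have h1 := hc.isBigO_integral (isBigO_one_of_continuous
    (F := fun t : ℝ => Complex.exp ((-(t * y) : ℝ) * Complex.I)) (by fun_prop))
  have h2 : Tendsto (fun n : ℕ => (n : ℝ) ^ (-((((0 : ℕ) : ℝ) + 1) / 2))) atTop (𝓝 0) :=
    (tendsto_rpow_neg_atTop (by norm_num)).comp tendsto_natCast_atTop_atTop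
  have h3 := (h1.mono (le_principal_iff.2 (mem_atTop 1))).trans_tendsto h2
  have h4 := (Complex.continuous_re.tendsto _).comp (h3.const_mul ((2 * π)⁻¹ : ℂ))
  simp only [mul_zero, Complex.zero_re] at h4
  exact h4

end IsStepLaw

/-! ### First step analysis -/

variable {Ω : Type*} [MeasurableSpace Ω]

/-- The random variables `X i` are measurable and independent, with common law `μ`. The law is a
parameter, so that the shifted sequence `X (i + 1)` satisfies the same hypothesis. -/
structure IsIID (P : Measure Ω) (X : ℕ → Ω → ℝ) (μ : Measure ℝ) : Prop where
  measurable : ∀ i, Measurable (X i)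
  indep : iIndepFun X P
  map_eq : ∀ i, P.map (X i) = μ

/-- The event that the walk started at `x` stays positive at the times `1, …, n`. -/
def survives (X : ℕ → Ω → ℝ) (n : ℕ) (x : ℝ) : Set Ω :=
  {ω | ∀ m ∈ Finset.Icc 1 n, 0 < x + walk X m ω}

omit [MeasurableSpace Ω] in
lemma setOf_lt_passageTime (X : ℕ → Ω → ℝ) (n : ℕ) (x : ℝ) :
    {ω | (n : ℕ∞) < passageTime X x ω} = survives X n x := by
  ext ω
  simp only [survives, Set.mem_ofPred_eq, Finset.mem_Icc, passageTime]
  rw [← ENat.add_one_le_iff (ENat.natCast_ne_top n), le_iInf₂_iff]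
  constructor
  · intro h m hm
    by_contra! hle
    have := h m ⟨hm.1, hle⟩
    have : n + 1 ≤ m := by exact_mod_cast this
    omega
  · intro h m hm
    by_contra! hlt
    have : m < n + 1 := by exact_mod_cast hlt
    have := h m ⟨hm.1, by omega⟩
    linarith [hm.2]

namespace IsIID

variable {P : Measure Ω} [IsProbabilityMeasure P] {X : ℕ → Ω → ℝ} {μ : Measure ℝ}

omit [IsProbabilityMeasure P] in
lemma shift (hX : IsIID P X μ) : IsIID P (fun i => X (i + 1)) μ :=
  ⟨fun _ => hX.measurable _, hX.indep.precomp (g := Nat.succ) Nat.succ_injective,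
    fun _ => hX.map_eq _⟩

lemma measureReal_survives_succ (hX : IsIID P X μ) (n : ℕ) (x : ℝ) :
    P.real (survives X (n + 1) x) =
      ∫ z, (if 0 < x + z then P.real (survives (fun i => X (i + 1)) n (x + z)) else 0) ∂μ := by
  -- `Y` is the sequence `X 1, …, X n`, continued by zeros
  set T : Finset ℕ := Finset.Icc 1 n with hT
  set g : (T → ℝ) → (ℕ → ℝ) := fun u i => if hi : i + 1 ∈ T then u ⟨i + 1, hi⟩ else 0 with hg
  have hgm : Measurable g := by
    refine measurable_pi_lambda _ fun i => ?_
    simp only [hg]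
    split_ifs <;> fun_prop
  set Y : Ω → ℕ → ℝ := fun ω => g (T.restrict fun i => X i ω) with hY
  have hYm : Measurable Y :=
    hgm.comp (measurable_pi_lambda _ fun _ => hX.measurable _)
  have hind : IndepFun (X 0) Y P := by
    have h1 := hX.indep.indepFun_finset {0} T (by simp [hT]) hX.measurable
    have h2 : Measurable fun u : ({0} : Finset ℕ) → ℝ => u ⟨0, Finset.mem_singleton_self 0⟩ :=
      measurable_pi_apply _
    exact h1.comp h2 hgm
  have hmap := (indepFun_iff_map_prod_eq_prod_map_map (hX.measurable 0).aemeasurable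
    hYm.aemeasurable).1 hind
  rw [hX.map_eq 0] at hmap
  have hμ : IsProbabilityMeasure μ := by
    rw [← hX.map_eq 0]
    exact Measure.isProbabilityMeasure_map (hX.measurable 0).aemeasurable
  have : IsProbabilityMeasure (P.map Y) := Measure.isProbabilityMeasure_map hYm.aemeasurable
  have hwalkY : ∀ m ∈ Finset.Icc 1 n, ∀ ω, ∑ i ∈ Finset.range m, Y ω i =
      walk (fun i => X (i + 1)) m ω := by
    intro m hm ω
    refine Finset.sum_congr rfl fun i hi => ?_
    have h1 := Finset.mem_Icc.1 hm
    have h2 := Finset.mem_range.1 hi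
    simp only [hY, hg]
    rw [dif_pos (by rw [hT, Finset.mem_Icc]; omega)]
    rfl
  have hwalk : ∀ m ω, walk X (m + 1) ω = X 0 ω + walk (fun i => X (i + 1)) m ω := by
    intro m ω
    rw [walk, Finset.sum_range_succ', add_comm]; rfl
  set A : Set (ℝ × (ℕ → ℝ)) := {p | 0 < x + p.1} ∩
    ⋂ m ∈ Finset.Icc 1 n, {p | 0 < x + p.1 + ∑ i ∈ Finset.range m, p.2 i} with hA
  have hAm : MeasurableSet A := by
    refine (measurableSet_lt measurable_const (by fun_prop)).inter
      (Finset.measurableSet_biInter _ fun m _ => measurableSet_lt measurable_const (by fun_prop))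
  have hpre : survives X (n + 1) x = (fun ω => (X 0 ω, Y ω)) ⁻¹' A := by
    ext ω
    simp only [survives, Set.mem_ofPred_eq, hA, Set.mem_preimage, Set.mem_inter_iff,
      Set.mem_iInter]
    constructor
    · intro hs
      refine ⟨?_, fun m hm => ?_⟩
      · have := hs 1 (by simp)
        rw [hwalk 0 ω] at this
        simpa [walk] using this
      · have h1 := hs (m + 1) (by have := Finset.mem_Icc.1 hm; rw [Finset.mem_Icc]; omega)
        rw [hwalk m ω] at h1
        rw [hwalkY m hm ω]
        linarith
    · rintro ⟨h0, hs⟩ m hm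
      obtain ⟨m, rfl⟩ : ∃ k, m = k + 1 := ⟨m - 1, by have := Finset.mem_Icc.1 hm; omega⟩
      rw [hwalk m ω]
      rcases Nat.eq_zero_or_pos m with rfl | hm0
      · simpa [walk] using h0
      · have hm' : m ∈ Finset.Icc 1 n := by
          have := Finset.mem_Icc.1 hm; rw [Finset.mem_Icc]; omega
        have h1 := hs m hm'
        rw [hwalkY m hm' ω] at h1
        linarith
  have hsec : ∀ z : ℝ, (P.map Y) (Prod.mk z ⁻¹' A) =
      if 0 < x + z then P (survives (fun i => X (i + 1)) n (x + z)) else 0 := by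
    intro z
    rw [Measure.map_apply hYm (measurable_prodMk_left hAm)]
    split_ifs with hz
    · congr 1
      ext ω
      simp only [survives, Set.mem_ofPred_eq, hA, Set.mem_preimage, Set.mem_inter_iff,
        Set.mem_iInter, hz, true_and]
      refine forall₂_congr fun m hm => ?_
      rw [hwalkY m hm ω]
    · have : Y ⁻¹' (Prod.mk z ⁻¹' A) = ∅ := by
        ext ω
        simp [hA, hz]
      rw [this, measure_empty]
  rw [measureReal_def, hpre, ← Measure.map_apply ((hX.measurable 0).prodMk hYm) hAm, hmap,
    Measure.prod_apply hAm, ← integral_toReal (measurable_measure_prodMk_left hAm).aemeasurable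
      (ae_of_all _ fun z => measure_lt_top _ _)]
  congr 1; ext z
  rw [hsec z]
  split_ifs <;> simp [measureReal_def]

lemma measureReal_walk_eq (hX : IsIID P X μ) {r : ℕ} (h : IsStepLaw r μ) (n : ℕ) (y : ℤ) :
    P.real {ω | walk X n ω = y} = latticeProb μ n y := by
  have hm : Measurable (walk X n) := by
    unfold walk
    exact Finset.measurable_sum _ fun i _ => hX.measurable i
  have hν : IsProbabilityMeasure (P.map (walk X n)) :=
    Measure.isProbabilityMeasure_map hm.aemeasurable
  have hint : ∀ᵐ s : ℝ ∂(P.map (walk X n)), ∃ k : ℤ, s = k := by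
    have hset : MeasurableSet {s : ℝ | ∃ k : ℤ, s = k} := by
      have : {s : ℝ | ∃ k : ℤ, s = k} = Set.range (Int.cast : ℤ → ℝ) := by
        ext s; simp [eq_comm]
      rw [this]
      exact (Set.countable_range _).measurableSet
    rw [ae_map_iff hm.aemeasurable hset]
    have h1 : ∀ i, ∀ᵐ ω ∂P, ∃ k : ℤ, X i ω = k := by
      intro i
      have h2 := h.left
      rw [← hX.map_eq i] at h2
      filter_upwards [ae_of_ae_map (hX.measurable i).aemeasurable h2] with ω hω
      obtain ⟨k, -, hk⟩ := hω
      exact ⟨k, hk⟩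
    filter_upwards [ae_all_iff.2 h1] with ω hω
    choose k hk using hω
    exact ⟨∑ i ∈ Finset.range n, k i, by simp [walk, hk]⟩
  have hchar : ∀ t, charFun (P.map (walk X n)) t = charFun μ t ^ n := by
    intro t
    have h1 := (hX.indep.restrict (Finset.range n)).charFun_map_fun_finsetSum_eq_prod
      (fun i _ => (hX.measurable i).aemeasurable)
    have h2 := congrFun h1 t
    simp only [hX.map_eq, Finset.prod_const, Finset.card_range, Pi.pow_apply] at h2
    exact h2
  have h3 := measureReal_singleton_eq hint y
  simp_rw [hchar] at h3
  have h4 : (P.map (walk X n)).real {(y : ℝ)} = P.real {ω | walk X n ω = y} := by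
    rw [map_measureReal_apply hm (measurableSet_singleton _)]
    rfl
  rw [← h4, latticeProb, J, ← h3, Complex.ofReal_re]

end IsIID

lemma IsStepLaw.measureReal_singleton_eq_latticeProb {r : ℕ} {μ : Measure ℝ}
    (h : IsStepLaw r μ) (y : ℤ) : μ.real {(y : ℝ)} = latticeProb μ 1 y := by
  have := h.isProbabilityMeasure
  have h1 := measureReal_singleton_eq (h.left.mono fun x hx => hx.imp fun k hk => hk.2) y
  simp only [latticeProb, J, pow_one]
  rw [← h1, Complex.ofReal_re]

namespace IsIID

variable {P : Measure Ω} [IsProbabilityMeasure P] {X : ℕ → Ω → ℝ} {μ : Measure ℝ}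

/-- Kemperman's formula `P (τ_x = m) = (x / m) P (S_m = -x)`, summed over `m ≤ n`. In the
induction on `n`, the first step is averaged by means of
`E [X_1; S_{m+1} = -x] = -x / (m + 1) P (S_{m+1} = -x)`. -/
theorem measureReal_survives_eq (hX : IsIID P X μ) {r : ℕ} (h : IsStepLaw r μ) (n : ℕ) {x : ℕ}
    (hx : 1 ≤ x) :
    P.real (survives X n x) =
      1 - ∑ m ∈ Finset.range n, (x : ℝ) / (m + 1) * latticeProb μ (m + 1) (-x) := by
  have := h.isProbabilityMeasure
  induction n generalizing X x with
  | zero => simp [survives]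
  | succ n ih =>
    rw [hX.measureReal_survives_succ]
    have hae : ∀ᵐ z : ℝ ∂μ, (if 0 < (x : ℝ) + z then
        P.real (survives (fun i => X (i + 1)) n (x + z)) else 0) =
        1 - Set.indicator {((-x : ℤ) : ℝ)} (fun _ => (x : ℝ)) z -
          ∑ m ∈ Finset.range n, (x / (m + 1) * latticeProb μ (m + 1) (((-x : ℤ) : ℝ) - z) +
            1 / (m + 1) * (z * latticeProb μ (m + 1) (((-x : ℤ) : ℝ) - z))) := by
      filter_upwards [h.left] with z hz
      obtain ⟨k, hk, rfl⟩ := hz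
      rcases lt_or_ge 0 ((x : ℤ) + k) with hpos | hneg
      · obtain ⟨w, hw⟩ := Int.eq_ofNat_of_zero_le hpos.le
        have hwr : (x : ℝ) + (k : ℝ) = (w : ℝ) := by exact_mod_cast hw
        have hne : (k : ℝ) ∉ ({((-x : ℤ) : ℝ)} : Set ℝ) := by
          rw [Set.mem_singleton_iff]
          intro h0
          have : k = -x := by exact_mod_cast h0
          omega
        have hw1 : 1 ≤ w := by omega
        rw [Set.indicator_of_notMem hne, sub_zero, hwr, if_pos (by exact_mod_cast hw1),
          ih hX.shift hw1]
        congr 1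
        refine Finset.sum_congr rfl fun m _ => ?_
        have : ((-x : ℤ) : ℝ) - k = -(w : ℝ) := by rw [← hwr]; push_cast; ring
        rw [this]
        generalize latticeProb μ (m + 1) (-(w : ℝ)) = q
        rw [← hwr]
        ring
      -- steps are at least `-1`, so the walk can be killed at once only from `1`, by reaching `0`;
      -- there the factor `x + z` vanishes and the indicator cancels the `1`
      · have hk1 : k = -1 := by omega
        have hx1 : x = 1 := by omega
        subst hk1 hx1
        simp
    rw [integral_congr_ae hae]
    have i1 : Integrable (fun z : ℝ => 1 - Set.indicator {((-x : ℤ) : ℝ)} (fun _ => (x : ℝ)) z)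
        μ :=
      (integrable_const _).sub ((integrable_const _).indicator (measurableSet_singleton _))
    have i2 : ∀ m ∈ Finset.range n, Integrable (fun z : ℝ =>
        (x : ℝ) / (m + 1) * latticeProb μ (m + 1) (((-x : ℤ) : ℝ) - z) +
          1 / (m + 1) * (z * latticeProb μ (m + 1) (((-x : ℤ) : ℝ) - z))) μ := fun m _ =>
      ((h.integral_latticeProb _ _).1.const_mul _).add
        ((h.integral_id_mul_latticeProb _ _).1.const_mul _)
    rw [integral_sub i1 (integrable_finsetSum _ i2), integral_finsetSum _ i2,
      integral_sub (integrable_const _)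
        ((integrable_const _).indicator (measurableSet_singleton _)),
      integral_indicator_const _ (measurableSet_singleton _),
      h.measureReal_singleton_eq_latticeProb, Finset.sum_range_succ']
    have i3 : ∀ m ∈ Finset.range n, ∫ z, ((x : ℝ) / (m + 1) *
        latticeProb μ (m + 1) (((-x : ℤ) : ℝ) - z) +
          1 / (m + 1) * (z * latticeProb μ (m + 1) (((-x : ℤ) : ℝ) - z))) ∂μ =
        (x : ℝ) / ((m + 1 : ℕ) + 1) * latticeProb μ (m + 1 + 1) (-x) := by
      intro m _
      rw [integral_add ((h.integral_latticeProb _ _).1.const_mul _)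
        ((h.integral_id_mul_latticeProb _ _).1.const_mul _), integral_const_mul,
        integral_const_mul, (h.integral_latticeProb _ _).2,
        (h.integral_id_mul_latticeProb _ _).2]
      push_cast
      have hm1 : (m : ℝ) + 1 ≠ 0 := by positivity
      have hm2 : (m : ℝ) + 1 + 1 ≠ 0 := by positivity
      field_simp
      ring
    rw [Finset.sum_congr rfl i3]
    simp
    ring

/-- A bound for the survival probability: either the walk is above `M` at time `n`, which is
controlled by the function `x ↦ x`, harmonic for the walk killed at `0`, or it is at one of the
points `1, …, M`. -/
lemma measureReal_survives_le (hX : IsIID P X μ) {r : ℕ} (h : IsStepLaw r μ) {M : ℕ} (hM : 1 ≤ M)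
    (n : ℕ) {x : ℕ} (hx : 1 ≤ x) :
    P.real (survives X n x) ≤
      (x : ℝ) / M + ∑ w ∈ Finset.Icc 1 M, latticeProb μ n ((w : ℝ) - x) := by
  have := h.isProbabilityMeasure
  have hM0 : (0 : ℝ) < M := by exact_mod_cast hM
  have hnonneg : ∀ (n : ℕ) (y : ℤ), 0 ≤ latticeProb μ n y := fun n y => by
    rw [← hX.measureReal_walk_eq h]; exact measureReal_nonneg
  induction n generalizing X x with
  | zero =>
    refine measureReal_le_one.trans ?_
    have hnn : ∀ w ∈ Finset.Icc 1 M, 0 ≤ latticeProb μ 0 ((w : ℝ) - x) := fun w _ => by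
      have := hnonneg 0 ((w : ℤ) - x)
      push_cast at this; exact this
    rcases le_or_gt x M with hxM | hxM
    · have h1 := Finset.single_le_sum hnn (Finset.mem_Icc.2 ⟨hx, hxM⟩)
      have h2 : latticeProb μ 0 ((x : ℝ) - x) = 1 := by
        have := hX.measureReal_walk_eq h 0 0
        simpa [walk] using this.symm
      rw [h2] at h1
      have : 0 ≤ (x : ℝ) / M := by positivity
      linarith
    · have h1 : 1 ≤ (x : ℝ) / M := by
        rw [one_le_div hM0]; exact_mod_cast hxM.le
      linarith [Finset.sum_nonneg hnn]
  | succ n ih =>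
    rw [hX.measureReal_survives_succ]
    have i1 : ∀ w ∈ Finset.Icc 1 M, Integrable (fun z => latticeProb μ n (((w : ℝ) - x) - z)) μ :=
      fun w _ => (h.integral_latticeProb n _).1
    have hid : Integrable (fun z : ℝ => z) μ := by
      simpa using h.integrable_pow (m := 1) (by omega)
    have i2 : Integrable (fun z : ℝ => ((x : ℝ) + z) / M) μ :=
      ((integrable_const _).add hid).div_const _
    have hle : ∀ᵐ z : ℝ ∂μ, (if 0 < (x : ℝ) + z then
        P.real (survives (fun i => X (i + 1)) n (x + z)) else 0) ≤
        ((x : ℝ) + z) / M + ∑ w ∈ Finset.Icc 1 M, latticeProb μ n (((w : ℝ) - x) - z) := by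
      filter_upwards [h.left] with z hz
      obtain ⟨k, hk, rfl⟩ := hz
      obtain ⟨w, hw⟩ := Int.eq_ofNat_of_zero_le (show 0 ≤ (x : ℤ) + k by omega)
      have hwr : (x : ℝ) + (k : ℝ) = (w : ℝ) := by exact_mod_cast hw
      simp_rw [sub_sub, hwr]
      rcases Nat.eq_zero_or_pos w with rfl | hw1
      · simp only [Nat.cast_zero, lt_irrefl, if_false, zero_div, zero_add, sub_zero]
        exact Finset.sum_nonneg fun w _ => by exact_mod_cast hnonneg n w
      · rw [if_pos (by exact_mod_cast hw1)]
        exact ih hX.shift hw1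
    refine (integral_mono_of_nonneg (ae_of_all _ fun z => ?_)
      (i2.add (integrable_finsetSum _ i1)) hle).trans_eq ?_
    · simp only [Pi.zero_apply]
      split_ifs
      · exact measureReal_nonneg
      · exact le_rfl
    · simp only [Pi.add_apply]
      rw [integral_add i2 (integrable_finsetSum _ i1), integral_finsetSum _ i1,
        integral_div, integral_add (integrable_const _) hid, h.mean]
      simp [(h.integral_latticeProb n _).2]

/-- The walk is recurrent: the first passage time is almost surely finite. -/
lemma tendsto_measureReal_survives (hX : IsIID P X μ) {r : ℕ} (h : IsStepLaw r μ) {x : ℕ}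
    (hx : 1 ≤ x) : Tendsto (fun n => P.real (survives X n x)) atTop (𝓝 0) := by
  rw [Metric.tendsto_atTop]
  intro ε hε
  obtain ⟨M, hM⟩ := exists_nat_gt ((x : ℝ) / (ε / 2))
  have hM0 : (0 : ℝ) < M := lt_of_le_of_lt (by positivity) hM
  have hM1 : 1 ≤ M := by exact_mod_cast hM0
  have hsum : Tendsto (fun n => ∑ w ∈ Finset.Icc 1 M, latticeProb μ n ((w : ℝ) - x)) atTop
      (𝓝 0) := by
    simpa using tendsto_finsetSum (Finset.Icc 1 M) fun w _ =>
      h.tendsto_latticeProb ((w : ℝ) - x)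
  obtain ⟨N, hN⟩ := eventually_atTop.1 (hsum.eventually (gt_mem_nhds (half_pos hε)))
  refine ⟨N, fun n hn => ?_⟩
  rw [Real.dist_eq, sub_zero, abs_of_nonneg measureReal_nonneg]
  have h1 := hX.measureReal_survives_le h hM1 n hx
  have h2 := hN n hn
  have h3 : (x : ℝ) / M < ε / 2 := by
    rw [div_lt_iff₀ (by positivity)] at hM
    rw [div_lt_iff₀ hM0]; linarith
  linarith

end IsIID

/-! ### The expansion of the survival probability -/

lemma tendsto_a_zero (k : ℕ) : Tendsto (fun n => a (k + 1) n) atTop (𝓝 0) := by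
  obtain ⟨L, -, hL⟩ := exists_tendsto_a k
  have h1 : Tendsto (fun n : ℕ => (n : ℝ) ^ (-((k : ℝ) + 1 / 2))) atTop (𝓝 0) :=
    (tendsto_rpow_neg_atTop (by positivity)).comp tendsto_natCast_atTop_atTop
  have h2 := hL.mul h1
  rw [mul_zero] at h2
  refine h2.congr' ?_
  filter_upwards [eventually_ge_atTop 1] with n hn
  have hn0 : (0 : ℝ) < n := by exact_mod_cast hn
  rw [mul_assoc, ← Real.rpow_add hn0, add_neg_cancel, Real.rpow_zero, mul_one]

/-- The polynomial `x θ(-x) / (k + 1/2)` attached to the coefficient `θ = θ_k` of the local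
expansion. -/
noncomputable def survivalPoly (θ : ℝ[X]) (k : ℕ) : ℝ[X] :=
  C (((k : ℝ) + 1 / 2)⁻¹) * (X * θ.comp (-X))

lemma eval_survivalPoly (θ : ℝ[X]) (k : ℕ) (x : ℝ) :
    (survivalPoly θ k).eval x = x * θ.eval (-x) / ((k : ℝ) + 1 / 2) := by
  simp only [survivalPoly, eval_mul, eval_C, eval_X, eval_comp, eval_neg]
  ring

lemma degree_survivalPoly {θ : ℝ[X]} {k : ℕ} (hθ : θ.degree = ((2 * k : ℕ) : WithBot ℕ)) :
    (survivalPoly θ k).degree = ((2 * k + 1 : ℕ) : WithBot ℕ) := by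
  have hk : ((k : ℝ) + 1 / 2)⁻¹ ≠ 0 := inv_ne_zero (by positivity)
  rw [survivalPoly, degree_C_mul hk, X_mul, degree_mul_X, degree_comp_neg_X, hθ]
  rfl

/-- The telescoping identity behind the passage from `θ_k` to `V_{k+1}`: the difference of
consecutive coefficients `a_m^{(k+1)}` is `(k + 1/2) / (m + 1)` times the coefficient itself. -/
lemma eval_survivalPoly_mul_a_sub (θ : ℝ[X]) (k m : ℕ) (x : ℝ) :
    (survivalPoly θ k).eval x * a (k + 1) m - (survivalPoly θ k).eval x * a (k + 1) (m + 1) =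
      x / (m + 1) * (θ.eval (-x) * a (k + 1) m) := by
  rw [a_succ_recurrence k (m + 1) (by omega), Nat.add_sub_cancel, eval_survivalPoly]
  have h1 : (k : ℝ) + 1 / 2 ≠ 0 := by positivity
  have h2 : ((m + 1 : ℕ) : ℝ) ≠ 0 := by positivity
  push_cast at *
  field_simp
  ring

/-- Summation of the local expansion over all times after `n`, by Kemperman's formula. -/
lemma IsIID.survives_expansion {Ω : Type*} [MeasurableSpace Ω] {P : Measure Ω}
    [IsProbabilityMeasure P] {X : ℕ → Ω → ℝ} {μ : Measure ℝ} (hX : IsIID P X μ) {r : ℕ}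
    (h : IsStepLaw r μ) {θ : ℕ → ℝ[X]} {K : ℝ}
    (hK : ∀ n : ℕ, 1 ≤ n → ∀ y : ℝ, |latticeProb μ n y -
        ∑ k ∈ Finset.range (r / 2 + 1), (θ k).eval y * a (k + 1) (n - 1)| ≤
      K * (1 + |y|) ^ (r + 1) * (n : ℝ) ^ (-(((r : ℝ) + 2) / 2)))
    {n x : ℕ} (hn : 1 ≤ n) (hx : 1 ≤ x) :
    |P.real (survives X n x) -
        ∑ k ∈ Finset.range (r / 2 + 1), (survivalPoly (θ k) k).eval (x : ℝ) * a (k + 1) n| ≤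
      K * x * (1 + x) ^ (r + 1) *
        ((n : ℝ) ^ (-(((r : ℝ) + 2) / 2)) / (((r : ℝ) + 2) / 2)) := by
  set γ : ℝ := ((r : ℝ) + 2) / 2 with hγ
  have hγ0 : 0 < γ := by positivity
  have hK0 : 0 ≤ K := by
    have h1 := (abs_nonneg _).trans (hK 1 le_rfl 0)
    simpa using h1
  set D : ℕ → ℝ := fun m => P.real (survives X m x) -
    ∑ k ∈ Finset.range (r / 2 + 1), (survivalPoly (θ k) k).eval (x : ℝ) * a (k + 1) m with hD
  have hstep : ∀ m : ℕ, |D m - D (m + 1)| ≤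
      K * x * (1 + x) ^ (r + 1) * ((m + 1 : ℕ) : ℝ) ^ (-1 - γ) := by
    intro m
    have hm0 : (0 : ℝ) < ((m + 1 : ℕ) : ℝ) := by positivity
    have h1 : D m - D (m + 1) = (x : ℝ) / ((m + 1 : ℕ) : ℝ) * (latticeProb μ (m + 1) (-x) -
        ∑ k ∈ Finset.range (r / 2 + 1), (θ k).eval (-(x : ℝ)) * a (k + 1) (m + 1 - 1)) := by
      simp only [hD]
      rw [hX.measureReal_survives_eq h _ hx, hX.measureReal_survives_eq h _ hx,
        Finset.sum_range_succ _ m, mul_sub, Finset.mul_sum]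
      have h2 : ∀ s t u v w : ℝ, 1 - s - u - (1 - (s + t) - v) = t - (u - v) := by
        intros; ring
      rw [h2 _ _ _ _ 0, ← Finset.sum_sub_distrib]
      simp_rw [eval_survivalPoly_mul_a_sub]
      push_cast
      simp
    have h3 := hK (m + 1) (by omega) (-x)
    rw [abs_neg, abs_of_nonneg (Nat.cast_nonneg x : (0 : ℝ) ≤ x)] at h3
    rw [h1, abs_mul, abs_of_nonneg (by positivity)]
    calc _ ≤ (x : ℝ) / ((m + 1 : ℕ) : ℝ) *
          (K * (1 + (x : ℝ)) ^ (r + 1) * ((m + 1 : ℕ) : ℝ) ^ (-γ)) := by gcongr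
      _ = _ := by
          rw [show -1 - γ = -γ - 1 by ring, Real.rpow_sub_one hm0.ne']
          ring
  have hsum : ∀ N, n ≤ N → |D n - D N| ≤
      K * x * (1 + x) ^ (r + 1) * ((n : ℝ) ^ (-γ) / γ) := by
    intro N hN
    have h1 : D n - D N = ∑ m ∈ Finset.Ico n N, (D m - D (m + 1)) := by
      rw [← neg_sub, ← Finset.sum_Ico_sub D hN, ← Finset.sum_neg_distrib]
      exact Finset.sum_congr rfl fun m _ => by ring
    rw [h1]
    calc _ ≤ ∑ m ∈ Finset.Ico n N,
          K * x * (1 + x) ^ (r + 1) * ((m + 1 : ℕ) : ℝ) ^ (-1 - γ) :=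
          (Finset.abs_sum_le_sum_abs _ _).trans (Finset.sum_le_sum fun m _ => hstep m)
      _ ≤ _ := by
          rw [← Finset.mul_sum]
          gcongr
          exact sum_rpow_le γ hγ0 n N hn hN
  have hlim : Tendsto D atTop (𝓝 0) := by
    have h1 := tendsto_finsetSum (Finset.range (r / 2 + 1)) fun k _ =>
      (tendsto_a_zero k).const_mul ((survivalPoly (θ k) k).eval (x : ℝ))
    simpa using (hX.tendsto_measureReal_survives h hx).sub h1
  have hlim' : Tendsto (fun N => |D n - D N|) atTop (𝓝 |D n|) := by
    simpa using (hlim.const_sub (D n)).abs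
  refine le_of_tendsto hlim' ?_
  filter_upwards [eventually_ge_atTop n] with N hN
  exact hsum N hN

lemma isStepLaw_map {Ω : Type*} [MeasurableSpace Ω] {P : Measure Ω} [IsProbabilityMeasure P]
    {Y : Ω → ℝ} {r : ℕ} (hY : Measurable Y) (hmoment : Integrable (fun ω => |Y ω| ^ (r + 3)) P)
    (hmean : ∫ ω, Y ω ∂P = 0) (hvar : 0 < ∫ ω, Y ω ^ 2 ∂P)
    (hleft : ∀ᵐ ω ∂P, ∃ k : ℤ, -1 ≤ k ∧ Y ω = k) (hspan : HasMaximalSpanOne P Y) :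
    IsStepLaw r (P.map Y) where
  isProbabilityMeasure := Measure.isProbabilityMeasure_map hY.aemeasurable
  integrable := (integrable_map_measure (by fun_prop) hY.aemeasurable).2 hmoment
  mean := by rw [integral_map hY.aemeasurable (by fun_prop)]; exact hmean
  variance_pos := by rw [integral_map hY.aemeasurable (by fun_prop)]; exact hvar
  left := by
    have hset : MeasurableSet {s : ℝ | ∃ k : ℤ, -1 ≤ k ∧ s = k} := by
      have h1 : {s : ℝ | ∃ k : ℤ, -1 ≤ k ∧ s = k} ⊆ Set.range (Int.cast : ℤ → ℝ) := by
        rintro s ⟨k, -, rfl⟩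
        exact ⟨k, rfl⟩
      exact ((Set.countable_range _).mono h1).measurableSet
    rw [ae_map_iff hY.aemeasurable hset]
    exact hleft
  span := fun d hd ⟨b, hb⟩ => hspan.2 d hd ⟨b, ae_of_ae_map hY.aemeasurable hb⟩

end LeftContinuousWalk

open LeftContinuousWalk in
theorem theorem2 {Ω : Type*} [MeasurableSpace Ω] (P : Measure Ω) [IsProbabilityMeasure P]
    (X : ℕ → Ω → ℝ) (r : ℕ)
    (hmeas : ∀ i, Measurable (X i))
    (hindep : iIndepFun X P)
    (hident : ∀ i, IdentDistrib (X i) (X 0) P P)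
    (hmoment : Integrable (fun ω => |X 0 ω| ^ (r + 3)) P)
    (hmean : ∫ ω, X 0 ω ∂P = 0)
    (hvar : 0 < ∫ ω, X 0 ω ^ 2 ∂P)
    (hleft : ∀ᵐ ω ∂P, ∃ k : ℤ, -1 ≤ k ∧ X 0 ω = k)
    (hspan : LeftContinuousWalk.HasMaximalSpanOne P (X 0)) :
    ∃ V θ : ℕ → Polynomial ℝ,
      -- degrees of the coefficient polynomials
      (∀ j ∈ Finset.Icc 1 (r / 2 + 1), (V j).degree = ((2 * j - 1 : ℕ) : WithBot ℕ)) ∧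
      (∀ k ∈ Finset.range (r / 2 + 1), (θ k).degree = ((2 * k : ℕ) : WithBot ℕ)) ∧
      -- expansion of the tail of the first passage time, uniformly in the starting point
      (∃ C : ℝ, ∀ n : ℕ, 1 ≤ n → ∀ x : ℕ, 1 ≤ x →
        |P.real {ω | (n : ℕ∞) < LeftContinuousWalk.passageTime X (x : ℝ) ω}
            - ∑ j ∈ Finset.Icc 1 (r / 2 + 1), (V j).eval (x : ℝ) * LeftContinuousWalk.a j n|
          ≤ C * ((1 + (x : ℝ) ^ (r + 2)) / (n : ℝ) ^ (((r : ℝ) + 2) / 2))) ∧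
      -- the `θ k` are the coefficients of the local expansion of the unconditioned walk
      (∃ C : ℝ, ∀ n : ℕ, 1 ≤ n → ∀ y : ℤ,
        |P.real {ω | LeftContinuousWalk.walk X n ω = (y : ℝ)}
            - ∑ k ∈ Finset.range (r / 2 + 1),
                (θ k).eval (y : ℝ) * LeftContinuousWalk.a (k + 1) (n - 1)|
          ≤ C * ((1 + |(y : ℝ)|) ^ (r + 1) / (n : ℝ) ^ (((r : ℝ) + 2) / 2))) ∧
      -- explicit form of the `V j`
      (∀ j ∈ Finset.Icc 1 (r / 2 + 1), ∀ x : ℝ,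
        (V j).eval x = x * (θ (j - 1)).eval (-x) / ((j : ℝ) - 1 / 2)) := by
  set μ := P.map (X 0) with hμ
  have hX : IsIID P X μ := ⟨hmeas, hindep, fun i => (hident i).map_eq⟩
  have h : IsStepLaw r μ := isStepLaw_map (hmeas 0) hmoment hmean hvar hleft hspan
  obtain ⟨c, hc⟩ := h.exists_isGaussianLike
  obtain ⟨θ, hθ, K, hK⟩ := hc.exists_local_expansion
  have hK0 : 0 ≤ K := by
    have h1 := (abs_nonneg _).trans (hK 1 le_rfl 0)
    simpa using h1
  refine ⟨fun j => survivalPoly (θ (j - 1)) (j - 1), θ, fun j hj => ?_, hθ,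
    ⟨K * 2 ^ (r + 2) / (((r : ℝ) + 2) / 2), fun n hn x hx => ?_⟩, ⟨K, fun n hn y => ?_⟩,
    fun j hj x => ?_⟩
  · have hj := Finset.mem_Icc.1 hj
    rw [degree_survivalPoly (hθ (j - 1) (Finset.mem_range.2 (by omega))),
      show 2 * (j - 1) + 1 = 2 * j - 1 by omega]
  · have hn0 : (0 : ℝ) < n := by exact_mod_cast hn
    have hx1 : (1 : ℝ) ≤ x := by exact_mod_cast hx
    have h1 := hX.survives_expansion h hK hn hx
    have h2 : ∑ j ∈ Finset.Icc 1 (r / 2 + 1),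
        (survivalPoly (θ (j - 1)) (j - 1)).eval (x : ℝ) * a j n =
        ∑ k ∈ Finset.range (r / 2 + 1), (survivalPoly (θ k) k).eval (x : ℝ) * a (k + 1) n := by
      rw [Finset.range_eq_Ico]
      exact (Finset.sum_Ico_add' (fun j =>
        (survivalPoly (θ (j - 1)) (j - 1)).eval (x : ℝ) * a j n) 0 (r / 2 + 1) 1).symm
    rw [setOf_lt_passageTime, h2]
    refine h1.trans ?_
    rw [Real.rpow_neg hn0.le]
    have h3 : (x : ℝ) * (1 + x) ^ (r + 1) ≤ 2 ^ (r + 2) * (1 + (x : ℝ) ^ (r + 2)) := by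
      calc (x : ℝ) * (1 + x) ^ (r + 1) ≤ (2 * x) * (2 * x) ^ (r + 1) := by
            gcongr <;> linarith
        _ = 2 ^ (r + 2) * (x : ℝ) ^ (r + 2) := by ring
        _ ≤ _ := by gcongr; linarith
    calc _ = (x : ℝ) * (1 + x) ^ (r + 1) *
          (K * ((n : ℝ) ^ (((r : ℝ) + 2) / 2))⁻¹ / (((r : ℝ) + 2) / 2)) := by ring
      _ ≤ 2 ^ (r + 2) * (1 + (x : ℝ) ^ (r + 2)) *
          (K * ((n : ℝ) ^ (((r : ℝ) + 2) / 2))⁻¹ / (((r : ℝ) + 2) / 2)) := by gcongr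
      _ = _ := by rw [div_eq_mul_inv (1 + (x : ℝ) ^ (r + 2))]; ring
  · have hn0 : (0 : ℝ) < n := by exact_mod_cast hn
    rw [hX.measureReal_walk_eq h]
    refine (hK n hn y).trans_eq ?_
    rw [Real.rpow_neg hn0.le]
    ring
  · have hj := Finset.mem_Icc.1 hj
    rw [eval_survivalPoly, Nat.cast_sub hj.1]
    congr 1
    push_cast; ring
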